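/- Let $\sigma\in L^2[0,1]$ be complex valued and let $r\ge 0$. For $\mu\in\mathbb C\setminus\{0\}$ consider the equation $y''+qy+\mu^2y=0$ on $[0,1]$ with the distributional potential $q=\sigma'$. A solution is a function $y\in W^{1,1}[0,1]$ whose quasi-derivative $y^{[1]}:=y'+\sigma y$ lies in $W^{1,1}[0,1]$ and which satisfies $(y^{[1]})'-\sigma y^{[1]}+\sigma^2y+\mu^2y=0$ a.e. on $[0,1]$. Put $$g(x)=\int_0^x e^{2i\mu(x-t)}\sigma(t)\,dt,\qquad h(x)=\int_x^1 e^{2i\mu(t-x)}\sigma(t)\,dt,$$ $$G_1(x)=\int_0^x e^{2i\mu(x-t)}\sigma^2(t)\,dt,\qquad G_2(x)=\int_x^1 e^{2i\mu(t-x)}\sigma^2(t)\,dt,$$ $$k_1(x)=\int_0^x\sigma(t)\int_t^1e^{2i\mu(s-t)}\sigma(s)\,ds\,dt,\qquad k_2(x)=\int_x^1\sigma(t)\int_0^te^{2i\mu(t-s)}\sigma(s)\,ds\,dt,$$ $$\rho(\mu)=\frac1{|\mu|}\int_0^1|\sigma|^2(|g|+|h|)\,dt+\int_0^1(|g|^2+|h|^2)\,dt+\int_0^1|\sigma|\,(|g|^2+|h|^2)\,dt+\frac1{|\mu|^2}.$$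 Theorem. There are constants $R,C>0$, depending only on $\sigma$ and $r$, such that for every $\mu$ with $\operatorname{Im}\mu>-r$ and $|\mu|>R$ the equation has a fundamental system (two linearly independent solutions) $y_1,y_2$, normalized by $$\tfrac12\Big(y_1+\tfrac{1}{i\mu}y_1^{[1]}\Big)(0)=1,\quad \tfrac12\Big(y_1-\tfrac{1}{i\mu}y_1^{[1]}\Big)(1)=0,\quad \tfrac12\Big(y_2+\tfrac{1}{i\mu}y_2^{[1]}\Big)(0)=0,\quad \tfrac12\Big(y_2-\tfrac{1}{i\mu}y_2^{[1]}\Big)(1)=1,$$ such that for all $x\in[0,1]$ $$y_1(x)=e^{i\mu x}\Big(1+h(x)-k_1(x)-\int_x^1e^{2i\mu(t-x)}\sigma(t)k_1(t)\,dt\Big)$$ $$\qquad+\frac{ie^{i\mu x}}{2\mu}\Big(-g(x)G_2(x)+G_2(x)+h(x)\int_0^x\sigma^2(t)\,dt+\int_0^x\sigma^2(t)\,dt\Big)+E_1(x,\mu),$$ $$y_2(x)=e^{i\mu(1-x)}\Big(1-g(x)-k_2(x)+\int_0^xe^{2i\mu(x-t)}\sigma(t)k_2(t)\,dt\Big)$$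 $$\qquad+\frac{ie^{i\mu(1-x)}}{2\mu}\Big(G_1(x)+h(x)G_1(x)-g(x)\int_x^1\sigma^2(t)\,dt+\int_x^1\sigma^2(t)\,dt\Big)+E_2(x,\mu),$$ where $|E_j(x,\mu)|\le C\rho(\mu)$ for $j=1,2$. -/

import Mathlib

open MeasureTheory Set Complex

noncomputable section

namespace SturmLiouville

/-- The open half-plane `Im μ > -r`. -/
def halfPlane (r : ℝ) : Set ℂ := {μ | -r < μ.im}

/-! ### Singular Sturm-Liouville equation `y'' + σ' y + μ² y = 0` on `[0,1]` -/

/-- `y` solves `y'' + σ' y + μ² y = 0` on `[0,1]` in the regularized sense, and `u` is its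
quasi-derivative `y^[1] = y' + σ y`: both `y` and `u` are absolutely continuous on `[0,1]`, and
`u = y' + σ y` and `u' - σ u + σ² y + μ² y = 0` hold almost everywhere on `[0,1]`. -/
structure IsSolution (σ : ℝ → ℂ) (μ : ℂ) (y u : ℝ → ℂ) : Prop where
  ac : AbsolutelyContinuousOnInterval y 0 1
  ac_quasi : AbsolutelyContinuousOnInterval u 0 1
  deriv_eq : ∀ᵐ x ∂(volume.restrict (Icc (0 : ℝ) 1)), HasDerivAt y (u x - σ x * y x) x
  quasi_deriv_eq : ∀ᵐ x ∂(volume.restrict (Icc (0 : ℝ) 1)),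
    HasDerivAt u (σ x * u x - σ x ^ 2 * y x - μ ^ 2 * y x) x

/-- First Dirac component of `(y, y^[1])`: the `d₁` in
`y = d₁ + d₂`, `y^[1] = i μ (d₁ - d₂)`. -/
def diracFst (μ : ℂ) (y u : ℝ → ℂ) (x : ℝ) : ℂ := (y x + u x / (I * μ)) / 2

/-- Second Dirac component of `(y, y^[1])`: the `d₂` in
`y = d₁ + d₂`, `y^[1] = i μ (d₁ - d₂)`. -/
def diracSnd (μ : ℂ) (y u : ℝ → ℂ) (x : ℝ) : ℂ := (y x - u x / (I * μ)) / 2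

/-! ### Integral operators and remainders for a Dirac system with off-diagonal `σ₁, σ₂` -/

/-- `(K₁ z)(x) = ∫₀ˣ σ₁(t) ∫ₜ¹ e^{2iμ(s-t)} σ₂(s) z(s) ds dt`. -/
def opK₁ (σ₁ σ₂ : ℝ → ℂ) (μ : ℂ) (z : ℝ → ℂ) (x : ℝ) : ℂ :=
  ∫ t in (0 : ℝ)..x, σ₁ t * ∫ s in t..1, cexp (2 * I * μ * ((s : ℂ) - t)) * σ₂ s * z s

/-- `(K₂ z)(x) = ∫ₓ¹ σ₂(t) ∫₀ᵗ e^{2iμ(t-s)} σ₁(s) z(s) ds dt`. -/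
def opK₂ (σ₁ σ₂ : ℝ → ℂ) (μ : ℂ) (z : ℝ → ℂ) (x : ℝ) : ℂ :=
  ∫ t in x..1, σ₂ t * ∫ s in (0 : ℝ)..t, cexp (2 * I * μ * ((t : ℂ) - s)) * σ₁ s * z s

/-- The constant function `e = 1`. -/
def unitFun : ℝ → ℂ := fun _ => 1

/-- `γ₀,₁(x, μ) = |∫₀ˣ e^{2iμ(x-t)} σ₁(t) dt|`. -/
def gamma01 (σ₁ : ℝ → ℂ) (x : ℝ) (μ : ℂ) : ℝ :=
  ‖∫ t in (0 : ℝ)..x, cexp (2 * I * μ * ((x : ℂ) - t)) * σ₁ t‖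

/-- `γ₀,₂(x, μ) = |∫ₓ¹ e^{2iμ(t-x)} σ₂(t) dt|`. -/
def gamma02 (σ₂ : ℝ → ℂ) (x : ℝ) (μ : ℂ) : ℝ :=
  ‖∫ t in x..1, cexp (2 * I * μ * ((t : ℂ) - x)) * σ₂ t‖

/-- `γ₁(μ)`, the `L²(0,1)` norm of `γ₀,₁(·, μ)`. -/
def gamma1 (σ₁ : ℝ → ℂ) (μ : ℂ) : ℝ := Real.sqrt (∫ s in (0 : ℝ)..1, gamma01 σ₁ s μ ^ 2)

/-- `γ₂(μ)`, the `L²(0,1)` norm of `γ₀,₂(·, μ)`. -/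
def gamma2 (σ₂ : ℝ → ℂ) (μ : ℂ) : ℝ := Real.sqrt (∫ s in (0 : ℝ)..1, gamma02 σ₂ s μ ^ 2)

/-- `γ̃(μ) = ∫₀¹ |σ₂| γ₀,₁² ds + ∫₀¹ |σ₁| γ₀,₂² ds`. -/
def gammaTilde (σ₁ σ₂ : ℝ → ℂ) (μ : ℂ) : ℝ :=
  (∫ s in (0 : ℝ)..1, ‖σ₂ s‖ * gamma01 σ₁ s μ ^ 2) +
    ∫ s in (0 : ℝ)..1, ‖σ₁ s‖ * gamma02 σ₂ s μ ^ 2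

open scoped Matrix.Norms.Frobenius in
/-- `k_P(μ) = ∫₀¹ ‖P(t)‖ (γ₀,₁(t, μ) + γ₀,₂(t, μ)) dt`, with the Frobenius norm. -/
def kP (P : ℝ → Matrix (Fin 2) (Fin 2) ℂ) (σ₁ σ₂ : ℝ → ℂ) (μ : ℂ) : ℝ :=
  ∫ t in (0 : ℝ)..1, ‖P t‖ * (gamma01 σ₁ t μ + gamma02 σ₂ t μ)

/-- `ρ(μ) = |μ|⁻¹ k_P(μ) + γ₁(μ)² + γ₂(μ)² + γ̃(μ) + |μ|⁻²`. -/
def rhoGen (P : ℝ → Matrix (Fin 2) (Fin 2) ℂ) (σ₁ σ₂ : ℝ → ℂ) (μ : ℂ) : ℝ :=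
  ‖μ‖⁻¹ * kP P σ₁ σ₂ μ + gamma1 σ₁ μ ^ 2 + gamma2 σ₂ μ ^ 2 + gammaTilde σ₁ σ₂ μ + (‖μ‖ ^ 2)⁻¹

/-- The perturbation matrix `P = (i/2) [[σ², σ²], [-σ², -σ²]]` of the Dirac system that is
equivalent to the Sturm-Liouville equation. -/
def pertMatrix (σ : ℝ → ℂ) (x : ℝ) : Matrix (Fin 2) (Fin 2) ℂ :=
  (I / 2) • !![σ x ^ 2, σ x ^ 2; -σ x ^ 2, -σ x ^ 2]

/-- The remainder `ρ(μ)` for the Sturm-Liouville equation (`σ₁ = σ₂ = σ`). -/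
def rho (σ : ℝ → ℂ) (μ : ℂ) : ℝ := rhoGen (pertMatrix σ) σ σ μ

end SturmLiouville

end

/-! Writing `y = e^{iμx}(A + B)` and `y^{[1]} = iμ e^{iμx}(A - B)` turns the equation into a
first-order system for `A`, `B` with off-diagonal coefficient `σ` and a perturbation of size `σ²/μ`
(`isSolution_of_dirac`). With `A(0) = 1` and `B(1) = 0` it becomes `A = 1 - V B + ε S(A+B)`, `B = T
A + ε S'(A+B)`, where `ε = i/(2μ)`, `V` and `S` integrate against `σ` and `σ²` from `0`, and `T` and
`S'` integrate from `1` with kernel `e^{2iμ(t-x)}`. Prescribing `B` at `1` is what keeps this kernel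
bounded in the half-plane.

Neither `V` nor `T` is small, but swapping integrals gives `T V f = V f · h + T(f h)` with `h = T
1`, and `h` tends to `0` uniformly by the Riemann-Lebesgue lemma (`exists_norm_upperInt_le`). So `T
V` is small for large `|μ|`, and a Neumann series solves the system with a stability bound
(`exists_solution_of_small`).

For the asymptotics, iterate the system and keep the terms in the formula; stability reduces the
error to the residual of this approximate solution. Put `τ = √ρ`. Then `ε` is `O(τ)`, and so are the
integrals of `|σ||g|` and `|σ||h|`. Every residual term is either a product of two such factors or
bounded by a summand of `ρ`, hence `O(ρ)` (`norm_residual_le`).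

The second solution comes from the first by `x ↦ 1 - x`, `σ ↦ -σ(1 - x)`, which exchanges `g` and
`h` up to sign and preserves `ρ`. Linear independence follows from the two boundary functionals. -/

namespace SturmLiouville

/-! ### Absolutely continuous primitives on `[0,1]` -/

/-- `F` is absolutely continuous on `[0,1]` with derivative `f` almost everywhere. -/
structure IsACPrimitive (F f : ℝ → ℂ) : Prop where
  ac : AbsolutelyContinuousOnInterval F 0 1
  ae_hasDerivAt : ∀ᵐ x, x ∈ Icc (0 : ℝ) 1 → HasDerivAt F (f x) x

namespace IsACPrimitive

variable {F G f g f' : ℝ → ℂ}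

theorem congr (hF : IsACPrimitive F f) (h : ∀ x ∈ Icc (0 : ℝ) 1, f x = f' x) :
    IsACPrimitive F f' where
  ac := hF.ac
  ae_hasDerivAt := by
    filter_upwards [hF.ae_hasDerivAt] with x hx hxI
    rw [← h x hxI]
    exact hx hxI

theorem add (hF : IsACPrimitive F f) (hG : IsACPrimitive G g) :
    IsACPrimitive (fun x => F x + G x) (fun x => f x + g x) where
  ac := hF.ac.fun_add hG.ac
  ae_hasDerivAt := by
    filter_upwards [hF.ae_hasDerivAt, hG.ae_hasDerivAt] with x h₁ h₂ hx
    exact (h₁ hx).add (h₂ hx)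

theorem sub (hF : IsACPrimitive F f) (hG : IsACPrimitive G g) :
    IsACPrimitive (fun x => F x - G x) (fun x => f x - g x) where
  ac := hF.ac.fun_sub hG.ac
  ae_hasDerivAt := by
    filter_upwards [hF.ae_hasDerivAt, hG.ae_hasDerivAt] with x h₁ h₂ hx
    exact (h₁ hx).sub (h₂ hx)

theorem mul (hF : IsACPrimitive F f) (hG : IsACPrimitive G g) :
    IsACPrimitive (fun x => F x * G x) (fun x => f x * G x + F x * g x) where
  ac := hF.ac.fun_smul hG.ac
  ae_hasDerivAt := by
    filter_upwards [hF.ae_hasDerivAt, hG.ae_hasDerivAt] with x h₁ h₂ hx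
    exact (h₁ hx).mul (h₂ hx)

theorem of_contDiff (hF : ContDiff ℝ 1 F) (h : ∀ x, HasDerivAt F (f x) x) :
    IsACPrimitive F f where
  ac := hF.contDiffOn.absolutelyContinuousOnInterval
  ae_hasDerivAt := .of_forall fun x _ => h x

theorem const (c : ℂ) : IsACPrimitive (fun _ => c) (fun _ => 0) :=
  of_contDiff contDiff_const fun x => hasDerivAt_const x c

theorem const_mul (c : ℂ) (hF : IsACPrimitive F f) :
    IsACPrimitive (fun x => c * F x) (fun x => c * f x) :=
  ((const c).mul hF).congr fun x _ => by ring

theorem continuousOn (hF : IsACPrimitive F f) : ContinuousOn F (Icc 0 1) := by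
  simpa using hF.ac.continuousOn

/-- Replaces Fubini and integration by parts below: an identity between integrals is proved by
differentiating the difference of its two sides and evaluating at one endpoint. -/
theorem exists_eq_const (hF : IsACPrimitive F f) (h : ∀ x ∈ Icc (0 : ℝ) 1, f x = 0) :
    ∃ c, ∀ x ∈ Icc (0 : ℝ) 1, F x = c := by
  have := hF.ac.const_of_ae_hasDerivAt_zero (by
    simpa using (hF.congr (f' := fun _ => 0) h).ae_hasDerivAt)
  simpa using this

end IsACPrimitive

theorem isACPrimitive_cexp (l : ℂ) :
    IsACPrimitive (fun x => cexp (l * x)) (fun x => l * cexp (l * x)) := by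
  refine IsACPrimitive.of_contDiff
    ((contDiff_const.mul Complex.ofRealCLM.contDiff).cexp) fun x => ?_
  have h : HasDerivAt (fun x : ℝ => l * (x : ℂ)) l x := by
    simpa using (Complex.ofRealCLM.hasDerivAt (x := x)).const_mul l
  simpa [mul_comm] using h.cexp

/-- The primitive of an integrable function. -/
theorem isACPrimitive_integral {w : ℝ → ℂ} (hw : IntervalIntegrable w volume 0 1) {c : ℝ}
    (hc : c ∈ Icc (0 : ℝ) 1) : IsACPrimitive (fun x => ∫ t in c..x, w t) w where
  ac := by
    have hmem : c ∈ uIcc (0 : ℝ) 1 := by simpa using hc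
    -- Increments of the primitive of `w` are dominated by those of the primitive of `‖w‖`, so the
    -- same `δ` serves.
    have h := hw.norm.absolutelyContinuousOnInterval_intervalIntegral hmem
    have hint : ∀ x ∈ uIcc (0 : ℝ) 1, IntervalIntegrable w volume c x := fun x hx =>
      hw.mono_set (uIcc_subset_uIcc hmem hx)
    rw [absolutelyContinuousOnInterval_iff] at h ⊢
    intro ε hε
    obtain ⟨δ, hδ, H⟩ := h ε hε
    refine ⟨δ, hδ, fun E hE hlen => lt_of_le_of_lt (Finset.sum_le_sum fun i hi => ?_) (H E hE hlen)⟩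
    have h1 : (E.2 i).1 ∈ uIcc (0 : ℝ) 1 := (hE.1 i hi).1
    have h2 : (E.2 i).2 ∈ uIcc (0 : ℝ) 1 := (hE.1 i hi).2
    rw [dist_comm, dist_eq_norm, dist_comm, dist_eq_norm,
      intervalIntegral.integral_interval_sub_left (hint _ h2) (hint _ h1),
      intervalIntegral.integral_interval_sub_left (hint _ h2).norm (hint _ h1).norm]
    exact intervalIntegral.norm_integral_le_abs_integral_norm
  ae_hasDerivAt := by
    filter_upwards [hw.ae_hasDerivAt_integral] with x hx hxI
    exact hx (by simpa using hxI) c (by simpa using hc)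

/-! ### Exponentially weighted primitives -/

/-- `∫₀ˣ e^{l(x-t)} w(t) dt`. -/
noncomputable def lowerInt (l : ℂ) (w : ℝ → ℂ) (x : ℝ) : ℂ :=
  ∫ t in (0 : ℝ)..x, cexp (l * ((x : ℂ) - t)) * w t

/-- `∫ₓ¹ e^{l(t-x)} w(t) dt`. -/
noncomputable def upperInt (l : ℂ) (w : ℝ → ℂ) (x : ℝ) : ℂ :=
  ∫ t in x..1, cexp (l * ((t : ℂ) - x)) * w t

theorem lowerInt_eq (l : ℂ) (w : ℝ → ℂ) (x : ℝ) :
    lowerInt l w x = cexp (l * x) * ∫ t in (0 : ℝ)..x, cexp (-l * t) * w t := by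
  rw [lowerInt, ← intervalIntegral.integral_const_mul]
  refine intervalIntegral.integral_congr fun t _ => ?_
  rw [← mul_assoc, ← Complex.exp_add]
  ring_nf

theorem upperInt_eq (l : ℂ) (w : ℝ → ℂ) (x : ℝ) :
    upperInt l w x = (-1) * (cexp (-l * x) * ∫ t in (1 : ℝ)..x, cexp (l * t) * w t) := by
  rw [upperInt, intervalIntegral.integral_symm, ← intervalIntegral.integral_const_mul, neg_one_mul]
  congr 1
  refine intervalIntegral.integral_congr fun t _ => ?_
  rw [← mul_assoc, ← Complex.exp_add]
  ring_nf

theorem cexp_mul_intervalIntegrable (l : ℂ) {w : ℝ → ℂ} (hw : IntervalIntegrable w volume 0 1) :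
    IntervalIntegrable (fun t : ℝ => cexp (l * t) * w t) volume 0 1 :=
  hw.continuousOn_mul (by fun_prop)

/-- Since `e^{l(x-t)}` factors, this is the product rule, i.e. variation of constants for `F' = l F
+ w`. -/
theorem isACPrimitive_lowerInt (l : ℂ) {w : ℝ → ℂ} (hw : IntervalIntegrable w volume 0 1) :
    IsACPrimitive (lowerInt l w) (fun x => l * lowerInt l w x + w x) := by
  rw [funext (lowerInt_eq l w)]
  refine ((isACPrimitive_cexp l).mul (isACPrimitive_integral
    (cexp_mul_intervalIntegrable (-l) hw) (c := 0) (by simp))).congr fun x _ => ?_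
  have h : cexp (l * x) * cexp (-l * x) = 1 := by rw [← Complex.exp_add]; simp
  linear_combination (w x) * h

theorem isACPrimitive_upperInt (l : ℂ) {w : ℝ → ℂ} (hw : IntervalIntegrable w volume 0 1) :
    IsACPrimitive (upperInt l w) (fun x => -l * upperInt l w x - w x) := by
  rw [funext (upperInt_eq l w)]
  refine (((isACPrimitive_cexp (-l)).mul (isACPrimitive_integral
    (cexp_mul_intervalIntegrable l hw) (c := 1) (by simp))).const_mul (-1)).congr fun x _ => ?_
  have h : cexp (l * x) * cexp (-l * x) = 1 := by rw [← Complex.exp_add]; simp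
  linear_combination -(w x) * h

@[simp] theorem lowerInt_zero_right (l : ℂ) (w : ℝ → ℂ) : lowerInt l w 0 = 0 := by
  simp [lowerInt]

@[simp] theorem upperInt_one_right (l : ℂ) (w : ℝ → ℂ) : upperInt l w 1 = 0 := by
  simp [upperInt]

theorem lowerInt_congr {l : ℂ} {v w : ℝ → ℂ} (h : ∀ t ∈ Icc (0 : ℝ) 1, v t = w t) {x : ℝ}
    (hx : x ∈ Icc (0 : ℝ) 1) : lowerInt l v x = lowerInt l w x := by
  refine intervalIntegral.integral_congr fun t ht => ?_
  rw [uIcc_of_le hx.1] at ht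
  simp only [h t ⟨ht.1, ht.2.trans hx.2⟩]

theorem upperInt_congr {l : ℂ} {v w : ℝ → ℂ} (h : ∀ t ∈ Icc (0 : ℝ) 1, v t = w t) {x : ℝ}
    (hx : x ∈ Icc (0 : ℝ) 1) : upperInt l v x = upperInt l w x := by
  refine intervalIntegral.integral_congr fun t ht => ?_
  rw [uIcc_of_le hx.2] at ht
  simp only [h t ⟨hx.1.trans ht.1, ht.2⟩]

theorem lowerInt_add {l : ℂ} {v w : ℝ → ℂ} (hv : IntervalIntegrable v volume 0 1)
    (hw : IntervalIntegrable w volume 0 1) {x : ℝ} (hx : x ∈ Icc (0 : ℝ) 1) :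
    lowerInt l (fun t => v t + w t) x = lowerInt l v x + lowerInt l w x := by
  have hsub : uIcc 0 x ⊆ uIcc (0 : ℝ) 1 := uIcc_subset_uIcc (by simp) (by simpa using hx)
  rw [lowerInt, lowerInt, lowerInt, ← intervalIntegral.integral_add
    ((hv.mono_set hsub).continuousOn_mul (by fun_prop))
    ((hw.mono_set hsub).continuousOn_mul (by fun_prop))]
  simp only [mul_add]

theorem upperInt_add {l : ℂ} {v w : ℝ → ℂ} (hv : IntervalIntegrable v volume 0 1)
    (hw : IntervalIntegrable w volume 0 1) {x : ℝ} (hx : x ∈ Icc (0 : ℝ) 1) :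
    upperInt l (fun t => v t + w t) x = upperInt l v x + upperInt l w x := by
  have hsub : uIcc x 1 ⊆ uIcc (0 : ℝ) 1 := uIcc_subset_uIcc (by simpa using hx) (by simp)
  rw [upperInt, upperInt, upperInt, ← intervalIntegral.integral_add
    ((hv.mono_set hsub).continuousOn_mul (by fun_prop))
    ((hw.mono_set hsub).continuousOn_mul (by fun_prop))]
  simp only [mul_add]

theorem lowerInt_const_mul (l c : ℂ) (w : ℝ → ℂ) (x : ℝ) :
    lowerInt l (fun t => c * w t) x = c * lowerInt l w x := by
  rw [lowerInt, lowerInt, ← intervalIntegral.integral_const_mul]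
  simp only [mul_left_comm c]

theorem upperInt_const_mul (l c : ℂ) (w : ℝ → ℂ) (x : ℝ) :
    upperInt l (fun t => c * w t) x = c * upperInt l w x := by
  rw [upperInt, upperInt, ← intervalIntegral.integral_const_mul]
  simp only [mul_left_comm c]

/-- Swapping the order of integration in `∫ₓ¹ e^{l(t-x)} σ(t) ∫₀ᵗ w`. -/
theorem upperInt_mul_lowerInt_zero (l : ℂ) {v w : ℝ → ℂ} (hv : IntervalIntegrable v volume 0 1)
    (hw : IntervalIntegrable w volume 0 1) {x : ℝ} (hx : x ∈ Icc (0 : ℝ) 1) :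
    upperInt l (fun t => v t * lowerInt 0 w t) x =
      lowerInt 0 w x * upperInt l v x + upperInt l (fun t => w t * upperInt l v t) x := by
  have hL := isACPrimitive_lowerInt 0 hw
  have hU := isACPrimitive_upperInt l hv
  have h1 := isACPrimitive_upperInt l
    (hv.mul_continuousOn (g := lowerInt 0 w) (by simpa using hL.continuousOn))
  have h2 := isACPrimitive_upperInt l
    (hw.mul_continuousOn (g := upperInt l v) (by simpa using hU.continuousOn))
  -- The difference `D` of the two sides satisfies `D' = -l D`, so `e^{lx} D` is constant; it
  -- vanishes at `1`.
  obtain ⟨c, hc⟩ := ((isACPrimitive_cexp l).mul (h1.sub ((hL.mul hU).add h2))).exists_eq_const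
    fun t _ => by ring
  have hc1 := hc 1 (by simp)
  have hcx := hc x hx
  simp only [upperInt_one_right, mul_zero, sub_self, add_zero] at hc1
  rw [← hc1] at hcx
  exact sub_eq_zero.1 ((mul_eq_zero.1 hcx).resolve_left (Complex.exp_ne_zero _))

/-- Swapping the order of integration in `∫₀ˣ v(t) ∫ₜ¹ e^{l(s-t)} w(s)`. -/
theorem lowerInt_zero_mul_upperInt (l : ℂ) {v w : ℝ → ℂ} (hv : IntervalIntegrable v volume 0 1)
    (hw : IntervalIntegrable w volume 0 1) {x : ℝ} (hx : x ∈ Icc (0 : ℝ) 1) :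
    lowerInt 0 (fun t => v t * upperInt l w t) x =
      lowerInt l v x * upperInt l w x + lowerInt 0 (fun t => w t * lowerInt l v t) x := by
  have hL := isACPrimitive_lowerInt l hv
  have hU := isACPrimitive_upperInt l hw
  have h1 := isACPrimitive_lowerInt 0
    (hv.mul_continuousOn (g := upperInt l w) (by simpa using hU.continuousOn))
  have h2 := isACPrimitive_lowerInt 0
    (hw.mul_continuousOn (g := lowerInt l v) (by simpa using hL.continuousOn))
  -- In the product the rates `l` and `-l` cancel, so the difference itself is constant; it vanishes
  -- at `0`.
  obtain ⟨c, hc⟩ := (h1.sub ((hL.mul hU).add h2)).exists_eq_const fun t _ => by ring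
  have hc1 := hc 0 (by simp)
  have hcx := hc x hx
  simp only [lowerInt_zero_right, zero_mul, sub_self, add_zero] at hc1
  rw [← hc1] at hcx
  exact sub_eq_zero.1 hcx

/-- `l` is admissible with bound `c` if `e^{l s}` is bounded by `c` for `s ∈ [0,1]`. -/
def ExpBound (l : ℂ) (c : ℝ) : Prop := ∀ s ∈ Icc (0 : ℝ) 1, ‖cexp (l * s)‖ ≤ c

theorem norm_lowerInt_le {l : ℂ} {c : ℝ} (hl : ExpBound l c) {w : ℝ → ℂ}
    (hw : IntervalIntegrable w volume 0 1) {x : ℝ} (hx : x ∈ Icc (0 : ℝ) 1) :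
    ‖lowerInt l w x‖ ≤ c * ∫ t in (0 : ℝ)..1, ‖w t‖ := by
  have hc : 0 ≤ c := (norm_nonneg _).trans (hl 0 (by simp))
  have hsub : uIcc 0 x ⊆ uIcc (0 : ℝ) 1 := uIcc_subset_uIcc (by simp) (by simpa using hx)
  calc ‖lowerInt l w x‖ ≤ ∫ t in (0 : ℝ)..x, c * ‖w t‖ := by
        refine intervalIntegral.norm_integral_le_of_norm_le hx.1 (.of_forall fun t ht => ?_)
          ((hw.mono_set hsub).norm.const_mul c)
        rw [norm_mul]
        gcongr
        simpa using hl (x - t) ⟨by linarith [ht.2], by linarith [ht.1, hx.2]⟩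
    _ = c * ∫ t in (0 : ℝ)..x, ‖w t‖ := intervalIntegral.integral_const_mul _ _
    _ ≤ c * ∫ t in (0 : ℝ)..1, ‖w t‖ := by
        gcongr
        exact intervalIntegral.integral_mono_interval le_rfl hx.1 hx.2
          (.of_forall fun t => norm_nonneg _) hw.norm

theorem norm_upperInt_le {l : ℂ} {c : ℝ} (hl : ExpBound l c) {w : ℝ → ℂ}
    (hw : IntervalIntegrable w volume 0 1) {x : ℝ} (hx : x ∈ Icc (0 : ℝ) 1) :
    ‖upperInt l w x‖ ≤ c * ∫ t in (0 : ℝ)..1, ‖w t‖ := by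
  have hc : 0 ≤ c := (norm_nonneg _).trans (hl 0 (by simp))
  have hsub : uIcc x 1 ⊆ uIcc (0 : ℝ) 1 := uIcc_subset_uIcc (by simpa using hx) (by simp)
  calc ‖upperInt l w x‖ ≤ ∫ t in x..1, c * ‖w t‖ := by
        refine intervalIntegral.norm_integral_le_of_norm_le hx.2 (.of_forall fun t ht => ?_)
          ((hw.mono_set hsub).norm.const_mul c)
        rw [norm_mul]
        gcongr
        simpa using hl (t - x) ⟨by linarith [ht.1], by linarith [ht.2, hx.1]⟩
    _ = c * ∫ t in x..1, ‖w t‖ := intervalIntegral.integral_const_mul _ _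
    _ ≤ c * ∫ t in (0 : ℝ)..1, ‖w t‖ := by
        gcongr
        exact intervalIntegral.integral_mono_interval hx.1 hx.2 le_rfl
          (.of_forall fun t => norm_nonneg _) hw.norm

/-! ### An abstract linear system -/

/-- Solvability, with a bound, of the system `p = -V q + ε S (p + q) + a`,
`q = T p + ε S' (p + q) + b` when `T V` and `ε` are small. -/
theorem exists_solution_of_small {E : Type*} [NormedAddCommGroup E] [NormedSpace ℂ E]
    [CompleteSpace E] {V T S S' : E →L[ℂ] E} {ε : ℂ} {M η : ℝ} (hM : 1 ≤ M)
    (hV : ‖V‖ ≤ M) (hT : ‖T‖ ≤ M) (hS : ‖S‖ ≤ M) (hS' : ‖S'‖ ≤ M)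
    (hTV : ∀ f, ‖T (V f)‖ ≤ η * ‖f‖) (hε : ‖ε‖ ≤ η) (hη : 14 * M ^ 3 * η ≤ 1) (a b : E) :
    ∃ p q : E, p = -V q + ε • S (p + q) + a ∧ q = T p + ε • S' (p + q) + b ∧
      ‖p‖ + ‖q‖ ≤ 6 * M ^ 2 * (‖a‖ + ‖b‖) := by
  have hη0 : 0 ≤ η := (norm_nonneg _).trans hε
  have hM0 : 0 ≤ M := by linarith
  have hM12 : M ≤ M ^ 2 := by nlinarith
  have hM23 : M ^ 2 ≤ M ^ 3 := by nlinarith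
  have eV : ∀ f, ‖V f‖ ≤ M * ‖f‖ := fun f => V.le_of_opNorm_le hV f
  have eT : ∀ f, ‖T f‖ ≤ M * ‖f‖ := fun f => T.le_of_opNorm_le hT f
  have eS : ∀ f, ‖ε • S f‖ ≤ η * (M * ‖f‖) := fun f => by
    rw [norm_smul]; gcongr; exact S.le_of_opNorm_le hS f
  have eS' : ∀ f, ‖ε • S' f‖ ≤ η * (M * ‖f‖) := fun f => by
    rw [norm_smul]; gcongr; exact S'.le_of_opNorm_le hS' f
  let D : E × E →L[ℂ] E := ContinuousLinearMap.fst ℂ E E + ContinuousLinearMap.snd ℂ E E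
  -- `F` is the second equation with the first inserted for `p`, and `G` is the first with the new
  -- second inserted for `q`. After this every term contains `T V` or `ε`, so `B = (G, F)` is a
  -- contraction.
  let F : E × E →L[ℂ] E :=
    -(T.comp (V.comp (ContinuousLinearMap.snd ℂ E E))) + T.comp (ε • S.comp D) + ε • S'.comp D
  let G : E × E →L[ℂ] E := -(V.comp F) + ε • S.comp D
  have hF : ∀ p q, F (p, q) = -T (V q) + T (ε • S (p + q)) + ε • S' (p + q) := fun p q => rfl
  have hG : ∀ p q, G (p, q) = -V (F (p, q)) + ε • S (p + q) := fun p q => rfl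
  have bF : ∀ p q, ‖F (p, q)‖ ≤ η * ‖q‖ + M * (η * (M * (‖p‖ + ‖q‖))) + η * (M * (‖p‖ + ‖q‖)) := by
    intro p q
    rw [hF]
    refine (norm_add₃_le).trans ?_
    rw [norm_neg]
    gcongr
    · exact hTV q
    · refine (eT _).trans ?_
      gcongr
      refine (eS _).trans ?_
      gcongr
      exact norm_add_le _ _
    · refine (eS' _).trans ?_
      gcongr
      exact norm_add_le _ _
  have bG : ∀ p q, ‖G (p, q)‖ ≤ M * ‖F (p, q)‖ + η * (M * (‖p‖ + ‖q‖)) := by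
    intro p q
    rw [hG]
    refine (norm_add_le _ _).trans ?_
    rw [norm_neg]
    gcongr
    · exact eV _
    · refine (eS _).trans ?_
      gcongr
      exact norm_add_le _ _
  let B : E × E →L[ℂ] E × E := G.prod F
  have hB : ‖B‖ ≤ 1 / 2 := by
    refine ContinuousLinearMap.opNorm_le_bound _ (by norm_num) fun z => ?_
    obtain ⟨p, q⟩ := z
    have hp : ‖p‖ ≤ ‖(p, q)‖ := norm_fst_le (p, q)
    have hq : ‖q‖ ≤ ‖(p, q)‖ := norm_snd_le (p, q)
    set N := ‖(p, q)‖
    have hN : 0 ≤ N := norm_nonneg _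
    have h1 : ‖F (p, q)‖ ≤ 5 * M ^ 2 * (η * N) := by
      calc ‖F (p, q)‖ ≤ η * N + M * (η * (M * (N + N))) + η * (M * (N + N)) :=
            (bF p q).trans (by gcongr)
        _ = (1 + 2 * M ^ 2 + 2 * M) * (η * N) := by ring
        _ ≤ 5 * M ^ 2 * (η * N) := by gcongr; nlinarith
    have h2 : ‖G (p, q)‖ ≤ 7 * M ^ 3 * (η * N) := by
      calc ‖G (p, q)‖ ≤ M * (5 * M ^ 2 * (η * N)) + η * (M * (N + N)) :=
            (bG p q).trans (by gcongr)
        _ = (5 * M ^ 3 + 2 * M) * (η * N) := by ring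
        _ ≤ 7 * M ^ 3 * (η * N) := by gcongr; linarith
    have h3 : 7 * M ^ 3 * (η * N) ≤ 1 / 2 * N := by
      nlinarith
    refine max_le (h2.trans h3) (h1.trans (le_trans ?_ h3))
    gcongr
    norm_num
  have hunit : IsUnit (1 - B) := isUnit_one_sub_of_norm_lt_one (by linarith)
  obtain ⟨u, hu⟩ := hunit
  -- The source terms after the same substitutions.
  let w : E × E := (a - V (T a + b), T a + b)
  obtain ⟨⟨p, q⟩, hz⟩ : ∃ z, (1 - B) z = w :=
    ⟨(↑u⁻¹ : E × E →L[ℂ] E × E) w, by rw [← hu, ← mul_apply_eq_comp]; simp⟩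
  have hp : p - G (p, q) = a - V (T a + b) := congrArg Prod.fst hz
  have hq : q - F (p, q) = T a + b := congrArg Prod.snd hz
  have hq1 : q = F (p, q) + T a + b := by rw [add_assoc, ← hq]; abel
  have hp1 : p = -V q + ε • S (p + q) + a := by
    have h := congrArg V hq1
    rw [add_assoc, map_add] at h
    rw [h, ← sub_eq_zero]
    rw [hG] at hp
    rw [← sub_eq_zero] at hp
    rw [← hp]
    abel
  have hq2 : q = T p + ε • S' (p + q) + b := by
    have h := congrArg T hp1
    rw [map_add, map_add, map_neg] at h
    rw [h]
    rw [hF] at hq1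
    exact hq1.trans (by abel)
  refine ⟨p, q, hp1, hq2, ?_⟩
  have e1 : ‖q‖ ≤ ‖F (p, q)‖ + M * ‖a‖ + ‖b‖ := by
    conv_lhs => rw [hq1]
    refine (norm_add₃_le).trans ?_
    gcongr
    exact eT _
  have e2 : ‖p‖ ≤ M * ‖q‖ + η * (M * (‖p‖ + ‖q‖)) + ‖a‖ := by
    conv_lhs => rw [hp1]
    refine (norm_add₃_le).trans ?_
    rw [norm_neg]
    gcongr
    · exact eV _
    · refine (eS _).trans ?_
      gcongr
      exact norm_add_le _ _
  have hp0 := norm_nonneg p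
  have hq0 := norm_nonneg q
  have ha0 := norm_nonneg a
  have hb0 := norm_nonneg b
  set N := ‖p‖ + ‖q‖ with hN
  have hN0 : 0 ≤ N := by positivity
  have hηN : 0 ≤ η * N := by positivity
  have h1 : ‖F (p, q)‖ ≤ 3 * M ^ 2 * (η * N) := by
    calc ‖F (p, q)‖ ≤ η * N + M * (η * (M * N)) + η * (M * N) :=
          (bF p q).trans (by gcongr; linarith)
      _ = (1 + M ^ 2 + M) * (η * N) := by ring
      _ ≤ 3 * M ^ 2 * (η * N) := by gcongr; nlinarith
  have h2 : ‖q‖ ≤ 3 * M ^ 2 * (η * N) + M * (‖a‖ + ‖b‖) := by nlinarith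
  have h3 : N ≤ 7 * M ^ 3 * (η * N) + 3 * M ^ 2 * (‖a‖ + ‖b‖) := by
    calc N ≤ (M + 1) * ‖q‖ + M * (η * N) + ‖a‖ := by rw [hN] at *; linarith
      _ ≤ (M + 1) * (3 * M ^ 2 * (η * N) + M * (‖a‖ + ‖b‖)) + M * (η * N) + (‖a‖ + ‖b‖) := by
          gcongr; linarith
      _ = (3 * M ^ 3 + 3 * M ^ 2 + M) * (η * N) + (M ^ 2 + M + 1) * (‖a‖ + ‖b‖) := by ring
      _ ≤ 7 * M ^ 3 * (η * N) + 3 * M ^ 2 * (‖a‖ + ‖b‖) := by gcongr <;> nlinarith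
  -- Half of `N` is absorbed on the left, which doubles `3 M²` to the stated `6 M²`.
  have h4 : 7 * M ^ 3 * (η * N) ≤ 1 / 2 * N := by nlinarith
  linarith

/-- Solvability of `a = e - V b + ε S (a + b)`, `b = T a + ε S' (a + b)` near an approximate
solution. -/
theorem exists_solution_near {E : Type*} [NormedAddCommGroup E] [NormedSpace ℂ E]
    [CompleteSpace E] {V T S S' : E →L[ℂ] E} {ε : ℂ} {M η : ℝ} (hM : 1 ≤ M)
    (hV : ‖V‖ ≤ M) (hT : ‖T‖ ≤ M) (hS : ‖S‖ ≤ M) (hS' : ‖S'‖ ≤ M)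
    (hTV : ∀ f, ‖T (V f)‖ ≤ η * ‖f‖) (hε : ‖ε‖ ≤ η) (hη : 14 * M ^ 3 * η ≤ 1) (e a₀ b₀ : E) :
    ∃ a b : E, a = e - V b + ε • S (a + b) ∧ b = T a + ε • S' (a + b) ∧
      ‖a - a₀‖ + ‖b - b₀‖ ≤ 6 * M ^ 2 * (‖e - V b₀ + ε • S (a₀ + b₀) - a₀‖ +
        ‖T a₀ + ε • S' (a₀ + b₀) - b₀‖) := by
  -- By linearity the correction solves the same system with the residuals as source.
  obtain ⟨p, q, hp, hq, hpq⟩ := exists_solution_of_small hM hV hT hS hS' hTV hε hη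
    (e - V b₀ + ε • S (a₀ + b₀) - a₀) (T a₀ + ε • S' (a₀ + b₀) - b₀)
  have hadd : a₀ + p + (b₀ + q) = a₀ + b₀ + (p + q) := by abel
  refine ⟨a₀ + p, b₀ + q, ?_, ?_, by simpa using hpq⟩
  · rw [hadd, map_add, map_add, smul_add]
    conv_lhs => rw [hp]
    abel
  · rw [hadd, map_add, map_add, smul_add]
    conv_lhs => rw [hq]
    abel

/-- The residuals of the approximate solution `a₀ = 1 - V h + ε (S 1 - g S' 1)`,
`b₀ = h - T V h + ε (S' 1 + S 1 h)` are of second order. -/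
theorem norm_residual_le {E : Type*} [NormedCommRing E] [NormedAlgebra ℂ E] [NormOneClass E]
    {V T S S' : E →L[ℂ] E} {g h a₀ b₀ : E} {ε : ℂ} {M τ : ℝ} (hM : 1 ≤ M)
    (hV : ‖V‖ ≤ M) (hT : ‖T‖ ≤ M) (hS : ‖S‖ ≤ M) (hS' : ‖S'‖ ≤ M) (hg : ‖g‖ ≤ M) (hh : ‖h‖ ≤ M)
    (hT1 : T 1 = h) (hTV : T (V h) = V h * h + T (h * h)) (hTS : T (S 1) = S 1 * h + S' h)
    (hVS : V (S' 1) = g * S' 1 + S g) (hε : ‖ε‖ ≤ τ)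
    (hVh : ∀ f, ‖V (f * h)‖ ≤ ‖f‖ * (M * τ)) (hTg : ∀ f, ‖T (f * g)‖ ≤ ‖f‖ * (M * τ))
    (hThh : ‖T (h * h)‖ ≤ M * τ ^ 2) (hSh : ‖ε‖ * ‖S h‖ ≤ M * τ ^ 2)
    (hSg : ‖ε‖ * ‖S g‖ ≤ M * τ ^ 2) (hSh' : ‖ε‖ * ‖S' h‖ ≤ M * τ ^ 2)
    (ha₀ : a₀ = 1 - V h + ε • (S 1 - g * S' 1))
    (hb₀ : b₀ = h - T (V h) + ε • (S' 1 + S 1 * h)) :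
    ‖1 - V b₀ + ε • S (a₀ + b₀) - a₀‖ ≤ 11 * M ^ 3 * τ ^ 2 ∧
      ‖T a₀ + ε • S' (a₀ + b₀) - b₀‖ ≤ 11 * M ^ 3 * τ ^ 2 := by
  have hτ : 0 ≤ τ := (norm_nonneg _).trans hε
  have hM0 : 0 ≤ M := by linarith
  have hM12 : M ≤ M ^ 2 := by nlinarith
  have hM23 : M ^ 2 ≤ M ^ 3 := by nlinarith
  have eV : ∀ f, ‖V f‖ ≤ M * ‖f‖ := fun f => V.le_of_opNorm_le hV f
  have eT : ∀ f, ‖T f‖ ≤ M * ‖f‖ := fun f => T.le_of_opNorm_le hT f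
  have eS1 : ‖S 1‖ ≤ M := by simpa using S.le_of_opNorm_le hS 1
  have eS1' : ‖S' 1‖ ≤ M := by simpa using S'.le_of_opNorm_le hS' 1
  have eVh : ‖V h‖ ≤ M * τ := by simpa using hVh 1
  have ea : ‖a₀ - 1‖ ≤ 3 * M ^ 2 * τ := by
    have : a₀ - 1 = -V h + ε • (S 1 - g * S' 1) := by rw [ha₀]; abel
    rw [this]
    calc _ ≤ ‖V h‖ + ‖ε‖ * (‖S 1‖ + ‖g‖ * ‖S' 1‖) := by
          refine (norm_add_le _ _).trans ?_
          rw [norm_neg, norm_smul]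
          gcongr
          exact (norm_sub_le _ _).trans (by gcongr; exact norm_mul_le _ _)
      _ ≤ M * τ + τ * (M + M * M) := by gcongr
      _ = (2 * M + M ^ 2) * τ := by ring
      _ ≤ 3 * M ^ 2 * τ := by gcongr; linarith
  have eb : ‖b₀ - h‖ ≤ 3 * M ^ 2 * τ := by
    have : b₀ - h = -T (V h) + ε • (S' 1 + S 1 * h) := by rw [hb₀]; abel
    rw [this]
    calc _ ≤ M * ‖V h‖ + ‖ε‖ * (‖S' 1‖ + ‖S 1‖ * ‖h‖) := by
          refine (norm_add_le _ _).trans ?_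
          rw [norm_neg, norm_smul]
          gcongr
          · exact eT _
          · exact (norm_add_le _ _).trans (by gcongr; exact norm_mul_le _ _)
      _ ≤ M * (M * τ) + τ * (M + M * M) := by gcongr
      _ = (M + 2 * M ^ 2) * τ := by ring
      _ ≤ 3 * M ^ 2 * τ := by gcongr; linarith
  -- `a₀ - 1` and `b₀ - h` are of first order in `τ`, so a further factor `ε` makes them of second
  -- order.
  have esmul : ∀ (L : E →L[ℂ] E) (f : E), ‖L‖ ≤ M → ‖f‖ ≤ 3 * M ^ 2 * τ →
      ‖ε • L f‖ ≤ 3 * M ^ 3 * τ ^ 2 := by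
    intro L f hL hf
    calc ‖ε • L f‖ = ‖ε‖ * ‖L f‖ := norm_smul _ _
      _ ≤ τ * (M * (3 * M ^ 2 * τ)) := by gcongr; exact (L.le_of_opNorm_le hL f).trans (by gcongr)
      _ = 3 * M ^ 3 * τ ^ 2 := by ring
  have hτ2 : 0 ≤ τ ^ 2 := by positivity
  have hc1 : M * τ ^ 2 ≤ M ^ 2 * τ ^ 2 := by gcongr
  have hc2 : M ^ 2 * τ ^ 2 ≤ M ^ 3 * τ ^ 2 := by gcongr
  constructor
  -- Expanding `T V h` and `V S' 1` by the swap identities cancels all first-order terms; the `-g S'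
  -- 1` in `a₀` is there to cancel the main part of `V S' 1`.
  · have key : 1 - V b₀ + ε • S (a₀ + b₀) - a₀ =
        V (V h * h) + V (T (h * h)) - ε • S g - ε • V (S 1 * h) + ε • S h
          + ε • S (a₀ - 1) + ε • S (b₀ - h) := by
      have h1 : V b₀ = V h - (V (V h * h) + V (T (h * h)))
          + ε • (g * S' 1 + S g + V (S 1 * h)) := by
        rw [hb₀, hTV]
        simp only [map_add, map_sub, map_smul, hVS]
      have h2 : S (a₀ + b₀) = S 1 + S h + S (a₀ - 1) + S (b₀ - h) := by
        rw [← map_add, ← map_add, ← map_add]; congr 1; abel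
      rw [h1, h2]
      generalize S (a₀ - 1) = X, S (b₀ - h) = Y
      rw [ha₀]
      simp only [smul_add, smul_sub]
      abel
    rw [key]
    have n1 : ‖V (V h * h)‖ ≤ M ^ 2 * τ ^ 2 := by
      calc _ ≤ ‖V h‖ * (M * τ) := hVh _
        _ ≤ M * τ * (M * τ) := by gcongr
        _ = M ^ 2 * τ ^ 2 := by ring
    have n2 : ‖V (T (h * h))‖ ≤ M ^ 2 * τ ^ 2 := by
      calc _ ≤ M * (M * τ ^ 2) := (eV _).trans (by gcongr)
        _ = M ^ 2 * τ ^ 2 := by ring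
    have n3 : ‖ε • S g‖ ≤ M * τ ^ 2 := by rwa [norm_smul]
    have n4 : ‖ε • V (S 1 * h)‖ ≤ M ^ 2 * τ ^ 2 := by
      calc _ = ‖ε‖ * ‖V (S 1 * h)‖ := norm_smul _ _
        _ ≤ τ * (M * (M * τ)) := by gcongr; exact (hVh _).trans (by gcongr)
        _ = M ^ 2 * τ ^ 2 := by ring
    have n5 : ‖ε • S h‖ ≤ M * τ ^ 2 := by rwa [norm_smul]
    have n6 := esmul S _ hS ea
    have n7 := esmul S _ hS eb
    have t1 := norm_add_le (V (V h * h) + V (T (h * h)) - ε • S g - ε • V (S 1 * h) + ε • S h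
          + ε • S (a₀ - 1)) (ε • S (b₀ - h))
    have t2 := norm_add_le (V (V h * h) + V (T (h * h)) - ε • S g - ε • V (S 1 * h) + ε • S h)
      (ε • S (a₀ - 1))
    have t3 := norm_add_le (V (V h * h) + V (T (h * h)) - ε • S g - ε • V (S 1 * h)) (ε • S h)
    have t4 := norm_sub_le (V (V h * h) + V (T (h * h)) - ε • S g) (ε • V (S 1 * h))
    have t5 := norm_sub_le (V (V h * h) + V (T (h * h))) (ε • S g)
    have t6 := norm_add_le (V (V h * h)) (V (T (h * h)))
    linarith
  -- One `S' h` comes from `T S 1`, the other from `S'` applied to the leading part `1 + h` of `a₀ +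
  -- b₀`.
  · have key : T a₀ + ε • S' (a₀ + b₀) - b₀ =
        ε • S' h + ε • S' h - ε • T (S' 1 * g) + ε • S' (a₀ - 1) + ε • S' (b₀ - h) := by
      have h1 : T a₀ = h - T (V h) + ε • (S 1 * h + S' h - T (S' 1 * g)) := by
        rw [ha₀]
        simp only [map_add, map_sub, map_smul, hTS, hT1, mul_comm g]
      have h2 : S' (a₀ + b₀) = S' 1 + S' h + S' (a₀ - 1) + S' (b₀ - h) := by
        rw [← map_add, ← map_add, ← map_add]; congr 1; abel
      rw [h1, h2]
      generalize S' (a₀ - 1) = X, S' (b₀ - h) = Y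
      rw [hb₀]
      simp only [smul_add, smul_sub]
      abel
    rw [key]
    have n1 : ‖ε • S' h‖ ≤ M * τ ^ 2 := by rwa [norm_smul]
    have n2 : ‖ε • T (S' 1 * g)‖ ≤ M ^ 2 * τ ^ 2 := by
      calc _ = ‖ε‖ * ‖T (S' 1 * g)‖ := norm_smul _ _
        _ ≤ τ * (M * (M * τ)) := by gcongr; exact (hTg _).trans (by gcongr)
        _ = M ^ 2 * τ ^ 2 := by ring
    have n6 := esmul S' _ hS' ea
    have n7 := esmul S' _ hS' eb
    have t1 := norm_add_le (ε • S' h + ε • S' h - ε • T (S' 1 * g) + ε • S' (a₀ - 1))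
      (ε • S' (b₀ - h))
    have t2 := norm_add_le (ε • S' h + ε • S' h - ε • T (S' 1 * g)) (ε • S' (a₀ - 1))
    have t3 := norm_sub_le (ε • S' h + ε • S' h) (ε • T (S' 1 * g))
    have t4 := norm_add_le (ε • S' h) (ε • S' h)
    have : 0 ≤ M ^ 3 * τ ^ 2 := by positivity
    linarith

/-! ### Uniform Riemann-Lebesgue lemma -/

/-- The modulus is `e^{-2s Im μ}`, at most `e^{2rs}`. The resulting constant is independent of `μ`,
which makes `R` and `C` uniform. -/
theorem ExpBound.of_mem_halfPlane {r : ℝ} (hr : 0 ≤ r) {μ : ℂ} (hμ : μ ∈ halfPlane r) :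
    ExpBound (2 * I * μ) (Real.exp (2 * r)) := by
  intro s hs
  rw [Complex.norm_exp]
  have hμ' : -r < μ.im := hμ
  have : (2 * I * μ * (s : ℂ)).re = -2 * μ.im * s := by simp
  rw [this]
  exact Real.exp_le_exp.2 (by nlinarith [hs.1, hs.2])

theorem expBound_zero {c : ℝ} (hc : 1 ≤ c) : ExpBound 0 c := fun s _ => by simpa using hc

/-- Integration by parts for a smooth density. -/
theorem mul_upperInt_of_contDiff (l : ℂ) {f : ℝ → ℂ} (hf : ContDiff ℝ 1 f) {x : ℝ}
    (hx : x ∈ Icc (0 : ℝ) 1) :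
    l * upperInt l f x = cexp (l * ((1 : ℝ) - x : ℝ)) * f 1 - f x - upperInt l (deriv f) x := by
  have hd : Continuous (deriv f) := hf.continuous_deriv le_rfl
  have hF : IsACPrimitive f (deriv f) := IsACPrimitive.of_contDiff hf fun t =>
    ((hf.differentiable (by norm_num)) t).hasDerivAt
  have h1 := (isACPrimitive_upperInt l (hf.continuous.intervalIntegrable 0 1)).const_mul l
  have h2 := isACPrimitive_upperInt l (hd.intervalIntegrable 0 1)
  -- `l U_f + f + U_{f'}`, with `U` the upper integral, satisfies `D' = -l D`, so it is fixed by its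
  -- value at `1`.
  obtain ⟨c, hc⟩ := ((isACPrimitive_cexp l).mul ((h1.add hF).add h2)).exists_eq_const
    fun t _ => by ring
  have hc1 := hc 1 (by simp)
  have hcx := hc x hx
  simp only [upperInt_one_right, mul_zero, zero_add, add_zero] at hc1
  rw [← hc1] at hcx
  have e : cexp (l * ((1 : ℝ) : ℂ)) = cexp (l * x) * cexp (l * ((1 : ℝ) - x : ℝ)) := by
    rw [← Complex.exp_add]; push_cast; ring_nf
  rw [e, mul_assoc] at hcx
  linear_combination mul_left_cancel₀ (Complex.exp_ne_zero _) hcx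

/-- Uniform Riemann-Lebesgue lemma in a half-plane. -/
theorem exists_norm_upperInt_le {w : ℝ → ℂ} (hw : IntervalIntegrable w volume 0 1) {r : ℝ}
    (hr : 0 ≤ r) {η : ℝ} (hη : 0 < η) :
    ∃ R > (0 : ℝ), ∀ μ ∈ halfPlane r, R < ‖μ‖ → ∀ x ∈ Icc (0 : ℝ) 1,
      ‖upperInt (2 * I * μ) w x‖ ≤ η := by
  set c := Real.exp (2 * r) with hc
  have hc0 : 0 < c := Real.exp_pos _
  have hmem : MemLp w 1 (volume.restrict (Ioc (0 : ℝ) 1)) :=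
    memLp_one_iff_integrable.2 ((intervalIntegrable_iff_integrableOn_Ioc_of_le zero_le_one).1 hw)
  -- Smooth approximation in `L¹`: the kernel bound `c` turns the error `η/(2c)` into `η/2`,
  -- uniformly in `x` and `μ`.
  obtain ⟨f, -, hf, hfw⟩ := hmem.exist_eLpNorm_sub_le (by simp) le_rfl (ε := η / (2 * c))
    (by positivity)
  have hf1 : ContDiff ℝ 1 f := hf.of_le (by exact_mod_cast le_top)
  have hfi : IntervalIntegrable f volume 0 1 := hf1.continuous.intervalIntegrable 0 1
  have hdi : IntervalIntegrable (deriv f) volume 0 1 :=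
    (hf1.continuous_deriv le_rfl).intervalIntegrable 0 1
  have hint : ∫ t in (0 : ℝ)..1, ‖w t - f t‖ ≤ η / (2 * c) := by
    rw [intervalIntegral.integral_of_le zero_le_one, integral_norm_eq_lintegral_enorm
      ((hw.sub hfi).1.aestronglyMeasurable), ← eLpNorm_one_eq_lintegral_enorm]
    exact ENNReal.toReal_le_of_le_ofReal (by positivity) hfw
  obtain ⟨B, hB⟩ := (isCompact_Icc (a := (0 : ℝ)) (b := 1)).exists_bound_of_continuousOn
    hf1.continuous.continuousOn
  have hB0 : 0 ≤ B := (norm_nonneg _).trans (hB 0 (by simp))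
  -- Bounds `2|μ|` times the integral of the smooth part, by parts; `|μ| > A/η` then leaves less
  -- than `η/2`.
  set A := c * B + B + c * ∫ t in (0 : ℝ)..1, ‖deriv f t‖ with hA
  have hA0 : 0 ≤ A := by
    have : 0 ≤ ∫ t in (0 : ℝ)..1, ‖deriv f t‖ :=
      intervalIntegral.integral_nonneg zero_le_one fun _ _ => norm_nonneg _
    positivity
  refine ⟨A / η + 1, by positivity, fun μ hμ hR x hx => ?_⟩
  have hl := ExpBound.of_mem_halfPlane hr hμ
  have hμ0 : 0 < ‖μ‖ := lt_trans (by positivity) hR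
  have h1 : ‖upperInt (2 * I * μ) (fun t => w t - f t) x‖ ≤ η / 2 := by
    refine (norm_upperInt_le hl (hw.sub hfi) hx).trans ?_
    calc c * ∫ t in (0 : ℝ)..1, ‖w t - f t‖ ≤ c * (η / (2 * c)) := by gcongr
      _ = η / 2 := by field_simp
  have h2 : ‖upperInt (2 * I * μ) f x‖ ≤ η / 2 := by
    have e := mul_upperInt_of_contDiff (2 * I * μ) hf1 hx
    have hle : ‖2 * I * μ * upperInt (2 * I * μ) f x‖ ≤ A := by
      rw [e]
      refine (norm_sub_le _ _).trans (add_le_add ((norm_sub_le _ _).trans (add_le_add ?_ ?_)) ?_)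
      · rw [norm_mul]
        gcongr
        · exact hl _ ⟨by linarith [hx.2], by linarith [hx.1]⟩
        · exact hB 1 (by simp)
      · exact hB x hx
      · exact norm_upperInt_le hl hdi hx
    have hn : ‖2 * I * μ‖ = 2 * ‖μ‖ := by simp
    rw [norm_mul, hn] at hle
    have hR' : A < ‖μ‖ * η := by
      have : A / η < ‖μ‖ := by linarith
      rwa [div_lt_iff₀ hη] at this
    nlinarith [norm_nonneg (upperInt (2 * I * μ) f x)]
  have h3 := upperInt_add (l := 2 * I * μ) (hw.sub hfi) hfi hx
  simp only [sub_add_cancel] at h3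
  calc ‖upperInt (2 * I * μ) w x‖
      = ‖upperInt (2 * I * μ) (fun t => w t - f t) x + upperInt (2 * I * μ) f x‖ := by
        rw [← h3]
    _ ≤ η / 2 + η / 2 := (norm_add_le _ _).trans (by gcongr)
    _ = η := by ring

/-! ### The integral operators on `C([0,1])` -/

/-- The constant extension of a continuous function on `[0,1]` to the line. -/
noncomputable def extend (f : C(Icc (0 : ℝ) 1, ℂ)) : ℝ → ℂ := IccExtend zero_le_one f

theorem extend_of_mem (f : C(Icc (0 : ℝ) 1, ℂ)) {t : ℝ} (ht : t ∈ Icc (0 : ℝ) 1) :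
    extend f t = f ⟨t, ht⟩ := IccExtend_of_mem _ _ ht

@[fun_prop] theorem continuous_extend (f : C(Icc (0 : ℝ) 1, ℂ)) : Continuous (extend f) :=
  f.continuous.Icc_extend'

@[simp] theorem extend_add (f g : C(Icc (0 : ℝ) 1, ℂ)) (t : ℝ) :
    extend (f + g) t = extend f t + extend g t := rfl

@[simp] theorem extend_mul (f g : C(Icc (0 : ℝ) 1, ℂ)) (t : ℝ) :
    extend (f * g) t = extend f t * extend g t := rfl

@[simp] theorem extend_smul (c : ℂ) (f : C(Icc (0 : ℝ) 1, ℂ)) (t : ℝ) :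
    extend (c • f) t = c * extend f t := rfl

@[simp] theorem extend_one (t : ℝ) : extend 1 t = 1 := rfl

theorem norm_extend_le (f : C(Icc (0 : ℝ) 1, ℂ)) (t : ℝ) : ‖extend f t‖ ≤ ‖f‖ :=
  f.norm_coe_le_norm _

theorem IntervalIntegrable.mul_extend {v : ℝ → ℂ} (hv : IntervalIntegrable v volume 0 1)
    (f : C(Icc (0 : ℝ) 1, ℂ)) : IntervalIntegrable (fun t => v t * extend f t) volume 0 1 :=
  hv.mul_continuousOn (continuous_extend f).continuousOn

theorem integral_norm_mul_extend_le {v : ℝ → ℂ} (hv : IntervalIntegrable v volume 0 1)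
    {f : C(Icc (0 : ℝ) 1, ℂ)} {A : ℝ} (hf : ‖f‖ ≤ A) :
    ∫ t in (0 : ℝ)..1, ‖v t * extend f t‖ ≤ (∫ t in (0 : ℝ)..1, ‖v t‖) * A := by
  rw [← intervalIntegral.integral_mul_const]
  refine intervalIntegral.integral_mono_on zero_le_one (IntervalIntegrable.mul_extend hv f).norm
    (hv.norm.mul_const _) fun t _ => ?_
  rw [norm_mul]
  gcongr
  exact (norm_extend_le f t).trans hf

/-- Only the first factor is estimated in sup norm. The second will be `g` or `h`, whose order `τ`
is available only in the mean against `|v|`. -/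
theorem integral_norm_mul_extend_mul_le {v : ℝ → ℂ} (hv : IntervalIntegrable v volume 0 1)
    (f g : C(Icc (0 : ℝ) 1, ℂ)) :
    ∫ t in (0 : ℝ)..1, ‖v t * extend (f * g) t‖ ≤
      ‖f‖ * ∫ t in (0 : ℝ)..1, ‖v t * extend g t‖ := by
  rw [← intervalIntegral.integral_const_mul]
  refine intervalIntegral.integral_mono_on zero_le_one
    (IntervalIntegrable.mul_extend hv (f * g)).norm
    ((IntervalIntegrable.mul_extend hv g).norm.const_mul _) fun t _ => ?_
  rw [extend_mul, mul_left_comm, norm_mul]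
  gcongr
  exact norm_extend_le f t

/-- `f ↦ ∫₀ˣ e^{l(x-t)} v(t) f(t) dt` on `C([0,1])`. -/
noncomputable def lowerOp {l : ℂ} {c : ℝ} (hl : ExpBound l c) {v : ℝ → ℂ}
    (hv : IntervalIntegrable v volume 0 1) : C(Icc (0 : ℝ) 1, ℂ) →L[ℂ] C(Icc (0 : ℝ) 1, ℂ) :=
  LinearMap.mkContinuous
    { toFun := fun f => ⟨fun x => lowerInt l (fun t => v t * extend f t) x,
        (isACPrimitive_lowerInt l (IntervalIntegrable.mul_extend hv f)).continuousOn.domRestrict⟩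
      map_add' := fun f g => by
        ext x
        simp only [ContinuousMap.coe_mk, ContinuousMap.add_apply, extend_add, mul_add]
        exact lowerInt_add (IntervalIntegrable.mul_extend hv f)
          (IntervalIntegrable.mul_extend hv g) x.2
      map_smul' := fun a f => by
        ext x
        simp only [ContinuousMap.coe_mk, ContinuousMap.smul_apply, extend_smul, mul_left_comm _ a]
        exact lowerInt_const_mul _ _ _ _ }
    (c * ∫ t in (0 : ℝ)..1, ‖v t‖) fun f => by
      have hc : 0 ≤ c := (norm_nonneg _).trans (hl 0 (by simp))
      refine (ContinuousMap.norm_le _ (mul_nonneg (mul_nonneg hc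
        (intervalIntegral.integral_nonneg zero_le_one fun _ _ => norm_nonneg _))
        (norm_nonneg _))).2 fun x => ?_
      refine (norm_lowerInt_le hl (IntervalIntegrable.mul_extend hv f) x.2).trans ?_
      rw [mul_assoc]
      gcongr
      exact integral_norm_mul_extend_le hv le_rfl

/-- `f ↦ ∫ₓ¹ e^{l(t-x)} v(t) f(t) dt` on `C([0,1])`. -/
noncomputable def upperOp {l : ℂ} {c : ℝ} (hl : ExpBound l c) {v : ℝ → ℂ}
    (hv : IntervalIntegrable v volume 0 1) : C(Icc (0 : ℝ) 1, ℂ) →L[ℂ] C(Icc (0 : ℝ) 1, ℂ) :=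
  LinearMap.mkContinuous
    { toFun := fun f => ⟨fun x => upperInt l (fun t => v t * extend f t) x,
        (isACPrimitive_upperInt l (IntervalIntegrable.mul_extend hv f)).continuousOn.domRestrict⟩
      map_add' := fun f g => by
        ext x
        simp only [ContinuousMap.coe_mk, ContinuousMap.add_apply, extend_add, mul_add]
        exact upperInt_add (IntervalIntegrable.mul_extend hv f)
          (IntervalIntegrable.mul_extend hv g) x.2
      map_smul' := fun a f => by
        ext x
        simp only [ContinuousMap.coe_mk, ContinuousMap.smul_apply, extend_smul, mul_left_comm _ a]
        exact upperInt_const_mul _ _ _ _ }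
    (c * ∫ t in (0 : ℝ)..1, ‖v t‖) fun f => by
      have hc : 0 ≤ c := (norm_nonneg _).trans (hl 0 (by simp))
      refine (ContinuousMap.norm_le _ (mul_nonneg (mul_nonneg hc
        (intervalIntegral.integral_nonneg zero_le_one fun _ _ => norm_nonneg _))
        (norm_nonneg _))).2 fun x => ?_
      refine (norm_upperInt_le hl (IntervalIntegrable.mul_extend hv f) x.2).trans ?_
      rw [mul_assoc]
      gcongr
      exact integral_norm_mul_extend_le hv le_rfl

section Operators

variable {l : ℂ} {c c' : ℝ} (hl : ExpBound l c) {v w : ℝ → ℂ}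
  (hv : IntervalIntegrable v volume 0 1) (hw : IntervalIntegrable w volume 0 1)
  (f g : C(Icc (0 : ℝ) 1, ℂ))

theorem lowerOp_apply (x : Icc (0 : ℝ) 1) :
    lowerOp hl hv f x = lowerInt l (fun t => v t * extend f t) x := rfl

theorem upperOp_apply (x : Icc (0 : ℝ) 1) :
    upperOp hl hv f x = upperInt l (fun t => v t * extend f t) x := rfl

theorem lowerOp_one_apply (x : Icc (0 : ℝ) 1) : lowerOp hl hv 1 x = lowerInt l v x := by
  simp [lowerOp_apply]

theorem upperOp_one_apply (x : Icc (0 : ℝ) 1) : upperOp hl hv 1 x = upperInt l v x := by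
  simp [upperOp_apply]

theorem ExpBound.nonneg (hl : ExpBound l c) : 0 ≤ c := (norm_nonneg _).trans (hl 0 (by simp))

theorem opNorm_lowerOp_le : ‖lowerOp hl hv‖ ≤ c * ∫ t in (0 : ℝ)..1, ‖v t‖ :=
  LinearMap.mkContinuous_norm_le _ (mul_nonneg hl.nonneg
    (intervalIntegral.integral_nonneg zero_le_one fun _ _ => norm_nonneg _)) _

theorem opNorm_upperOp_le : ‖upperOp hl hv‖ ≤ c * ∫ t in (0 : ℝ)..1, ‖v t‖ :=
  LinearMap.mkContinuous_norm_le _ (mul_nonneg hl.nonneg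
    (intervalIntegral.integral_nonneg zero_le_one fun _ _ => norm_nonneg _)) _

/-- Finer than the operator norm: it retains the weighted mean of `f`, which is the kind of quantity
`ρ` controls. -/
theorem norm_lowerOp_le : ‖lowerOp hl hv f‖ ≤ c * ∫ t in (0 : ℝ)..1, ‖v t * extend f t‖ :=
  (ContinuousMap.norm_le _ (mul_nonneg hl.nonneg
    (intervalIntegral.integral_nonneg zero_le_one fun _ _ => norm_nonneg _))).2 fun x =>
    norm_lowerInt_le hl (IntervalIntegrable.mul_extend hv f) x.2

theorem norm_upperOp_le : ‖upperOp hl hv f‖ ≤ c * ∫ t in (0 : ℝ)..1, ‖v t * extend f t‖ :=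
  (ContinuousMap.norm_le _ (mul_nonneg hl.nonneg
    (intervalIntegral.integral_nonneg zero_le_one fun _ _ => norm_nonneg _))).2 fun x =>
    norm_upperInt_le hl (IntervalIntegrable.mul_extend hv f) x.2

/-- The key cancellation: both terms on the right contain the oscillatory integral `upperOp hl hv
1`, so the composition is small when that function is. -/
theorem upperOp_lowerOp (h0 : ExpBound 0 c') :
    upperOp hl hv (lowerOp h0 hw f) =
      lowerOp h0 hw f * upperOp hl hv 1 + upperOp hl hw (f * upperOp hl hv 1) := by
  ext x
  have h := upperInt_mul_lowerInt_zero l hv (IntervalIntegrable.mul_extend hw f) x.2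
  rw [ContinuousMap.add_apply, ContinuousMap.mul_apply, upperOp_one_apply, lowerOp_apply]
  refine Eq.trans ?_ (h.trans (congrArg _ ?_))
  · refine upperInt_congr (fun t ht => ?_) x.2
    rw [extend_of_mem _ ht, lowerOp_apply]
  · refine upperInt_congr (fun t ht => ?_) x.2
    rw [extend_mul, extend_of_mem (upperOp hl hv 1) ht, upperOp_one_apply, mul_assoc]

theorem lowerOp_upperOp_one (h0 : ExpBound 0 c') :
    lowerOp h0 hv (upperOp hl hw 1) =
      lowerOp hl hv 1 * upperOp hl hw 1 + lowerOp h0 hw (lowerOp hl hv 1) := by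
  ext x
  have h := lowerInt_zero_mul_upperInt l hv hw x.2
  rw [ContinuousMap.add_apply, ContinuousMap.mul_apply, upperOp_one_apply, lowerOp_one_apply]
  refine Eq.trans ?_ (h.trans (congrArg _ ?_))
  · refine lowerInt_congr (fun t ht => ?_) x.2
    rw [extend_of_mem _ ht, upperOp_one_apply]
  · refine lowerInt_congr (fun t ht => ?_) x.2
    rw [extend_of_mem (lowerOp hl hv 1) ht, lowerOp_one_apply]

end Operators

/-! ### Lower bounds for `ρ` -/

open scoped Matrix.Norms.Frobenius in
-- Four entries of modulus `|σ|²/2`, so the Frobenius normalization produces no extra constant.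
theorem norm_pertMatrix (σ : ℝ → ℂ) (x : ℝ) : ‖pertMatrix σ x‖ = ‖σ x ^ 2‖ := by
  have h4 : Real.sqrt 4 = 2 := by
    rw [show (4 : ℝ) = 2 ^ 2 by norm_num]; exact Real.sqrt_sq (by norm_num)
  rw [pertMatrix, norm_smul, Matrix.frobenius_norm_def]
  have : (‖I / 2‖ : ℝ) = 1 / 2 := by simp
  rw [this]
  simp only [Fin.sum_univ_two, Matrix.of_apply, Matrix.cons_val', Matrix.cons_val_zero,
    Matrix.cons_val_one, Matrix.cons_val_fin_one, norm_neg, norm_pow]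
  rw [show (‖σ x‖ ^ 2) ^ (2 : ℝ) + (‖σ x‖ ^ 2) ^ (2 : ℝ) + ((‖σ x‖ ^ 2) ^ (2 : ℝ)
    + (‖σ x‖ ^ 2) ^ (2 : ℝ)) = 4 * (‖σ x‖ ^ 2) ^ (2 : ℝ) by ring, ← Real.sqrt_eq_rpow,
    Real.rpow_two, Real.sqrt_mul (by norm_num), Real.sqrt_sq (by positivity), h4]
  ring

theorem rho_eq (σ : ℝ → ℂ) (μ : ℂ) :
    rho σ μ = ‖μ‖⁻¹ * (∫ t in (0 : ℝ)..1, ‖σ t ^ 2‖ *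
        (‖lowerInt (2 * I * μ) σ t‖ + ‖upperInt (2 * I * μ) σ t‖))
      + (∫ t in (0 : ℝ)..1, ‖lowerInt (2 * I * μ) σ t‖ ^ 2)
      + (∫ t in (0 : ℝ)..1, ‖upperInt (2 * I * μ) σ t‖ ^ 2)
      + ((∫ t in (0 : ℝ)..1, ‖σ t‖ * ‖lowerInt (2 * I * μ) σ t‖ ^ 2)
        + ∫ t in (0 : ℝ)..1, ‖σ t‖ * ‖upperInt (2 * I * μ) σ t‖ ^ 2) + (‖μ‖ ^ 2)⁻¹ := by
  have h1 : gamma1 σ μ ^ 2 = ∫ t in (0 : ℝ)..1, ‖lowerInt (2 * I * μ) σ t‖ ^ 2 :=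
    Real.sq_sqrt (intervalIntegral.integral_nonneg zero_le_one fun _ _ => sq_nonneg _)
  have h2 : gamma2 σ μ ^ 2 = ∫ t in (0 : ℝ)..1, ‖upperInt (2 * I * μ) σ t‖ ^ 2 :=
    Real.sq_sqrt (intervalIntegral.integral_nonneg zero_le_one fun _ _ => sq_nonneg _)
  rw [rho, rhoGen, h1, h2, kP, gammaTilde]
  simp only [norm_pertMatrix]
  rfl

/-- All summands of `ρ` are nonnegative. The residual estimate needs only these five; the unweighted
`L²` norms are dropped. -/
theorem rho_lower_bounds {σ : ℝ → ℂ} (hσ : IntervalIntegrable σ volume 0 1)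
    (hσ2 : IntervalIntegrable (fun t => σ t ^ 2) volume 0 1) (μ : ℂ) :
    ‖μ‖⁻¹ * (∫ t in (0 : ℝ)..1, ‖σ t ^ 2 * lowerInt (2 * I * μ) σ t‖) ≤ rho σ μ ∧
    ‖μ‖⁻¹ * (∫ t in (0 : ℝ)..1, ‖σ t ^ 2 * upperInt (2 * I * μ) σ t‖) ≤ rho σ μ ∧
    (∫ t in (0 : ℝ)..1, ‖σ t‖ * ‖lowerInt (2 * I * μ) σ t‖ ^ 2) ≤ rho σ μ ∧
    (∫ t in (0 : ℝ)..1, ‖σ t‖ * ‖upperInt (2 * I * μ) σ t‖ ^ 2) ≤ rho σ μ ∧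
    (‖μ‖ ^ 2)⁻¹ ≤ rho σ μ := by
  have hg : ContinuousOn (lowerInt (2 * I * μ) σ) (uIcc 0 1) := by
    simpa using (isACPrimitive_lowerInt (2 * I * μ) hσ).continuousOn
  have hh : ContinuousOn (upperInt (2 * I * μ) σ) (uIcc 0 1) := by
    simpa using (isACPrimitive_upperInt (2 * I * μ) hσ).continuousOn
  have nn : ∀ u : ℝ → ℝ, (∀ t, 0 ≤ u t) → 0 ≤ ∫ t in (0 : ℝ)..1, u t := fun u hu =>
    intervalIntegral.integral_nonneg zero_le_one fun t _ => hu t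
  have p1 := nn (fun t => ‖lowerInt (2 * I * μ) σ t‖ ^ 2) fun t => by positivity
  have p2 := nn (fun t => ‖upperInt (2 * I * μ) σ t‖ ^ 2) fun t => by positivity
  have p3 := nn (fun t => ‖σ t‖ * ‖lowerInt (2 * I * μ) σ t‖ ^ 2) fun t => by positivity
  have p4 := nn (fun t => ‖σ t‖ * ‖upperInt (2 * I * μ) σ t‖ ^ 2) fun t => by positivity
  have p5 : 0 ≤ (‖μ‖ ^ 2)⁻¹ := by positivity
  have q1 := nn (fun t => ‖σ t ^ 2 * lowerInt (2 * I * μ) σ t‖) fun t => norm_nonneg _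
  have q2 := nn (fun t => ‖σ t ^ 2 * upperInt (2 * I * μ) σ t‖) fun t => norm_nonneg _
  have hsplit : (∫ t in (0 : ℝ)..1, ‖σ t ^ 2‖ *
        (‖lowerInt (2 * I * μ) σ t‖ + ‖upperInt (2 * I * μ) σ t‖)) =
      (∫ t in (0 : ℝ)..1, ‖σ t ^ 2 * lowerInt (2 * I * μ) σ t‖) +
        ∫ t in (0 : ℝ)..1, ‖σ t ^ 2 * upperInt (2 * I * μ) σ t‖ := by
    rw [← intervalIntegral.integral_add (hσ2.mul_continuousOn hg).norm
      (hσ2.mul_continuousOn hh).norm]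
    simp only [norm_mul, mul_add]
  have hm : 0 ≤ ‖μ‖⁻¹ := by positivity
  have r1 := mul_nonneg hm q1
  have r2 := mul_nonneg hm q2
  rw [rho_eq, hsplit, mul_add]
  refine ⟨?_, ?_, ?_, ?_, ?_⟩ <;> linarith

/-- `∫ |v| |f| ≤ τ (∫ |v| + 1)` as soon as `∫ |v| |f|² ≤ τ²`. -/
theorem integral_norm_mul_le_of_sq {v : ℝ → ℂ} (hv : IntervalIntegrable v volume 0 1)
    (f : C(Icc (0 : ℝ) 1, ℂ)) {τ : ℝ} (hτ : 0 < τ)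
    (h : ∫ t in (0 : ℝ)..1, ‖v t‖ * ‖extend f t‖ ^ 2 ≤ τ ^ 2) :
    ∫ t in (0 : ℝ)..1, ‖v t * extend f t‖ ≤ τ * ((∫ t in (0 : ℝ)..1, ‖v t‖) + 1) := by
  have hi : IntervalIntegrable (fun t => ‖v t‖ * ‖extend f t‖ ^ 2) volume 0 1 :=
    hv.norm.mul_continuousOn (by fun_prop)
  calc ∫ t in (0 : ℝ)..1, ‖v t * extend f t‖
      ≤ ∫ t in (0 : ℝ)..1, (τ * ‖v t‖ + τ⁻¹ * (‖v t‖ * ‖extend f t‖ ^ 2)) := by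
        refine intervalIntegral.integral_mono_on zero_le_one
          (IntervalIntegrable.mul_extend hv f).norm
          ((hv.norm.const_mul _).add (hi.const_mul _)) fun t _ => ?_
        rw [norm_mul, show τ * ‖v t‖ + τ⁻¹ * (‖v t‖ * ‖extend f t‖ ^ 2) =
          ‖v t‖ * (τ + τ⁻¹ * ‖extend f t‖ ^ 2) by ring]
        gcongr
        -- The pointwise inequality `s ≤ τ + s²/τ` serves instead of Cauchy-Schwarz.
        have : τ + τ⁻¹ * ‖extend f t‖ ^ 2 - ‖extend f t‖ =
            τ⁻¹ * ((τ - ‖extend f t‖ / 2) ^ 2 + 3 / 4 * ‖extend f t‖ ^ 2) := by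
          field_simp; ring
        have h0 : 0 ≤ τ⁻¹ * ((τ - ‖extend f t‖ / 2) ^ 2 + 3 / 4 * ‖extend f t‖ ^ 2) := by
          positivity
        linarith
    _ = τ * (∫ t in (0 : ℝ)..1, ‖v t‖) + τ⁻¹ * ∫ t in (0 : ℝ)..1, ‖v t‖ * ‖extend f t‖ ^ 2 := by
        rw [intervalIntegral.integral_add (hv.norm.const_mul _) (hi.const_mul _),
          intervalIntegral.integral_const_mul, intervalIntegral.integral_const_mul]
    _ ≤ τ * (∫ t in (0 : ℝ)..1, ‖v t‖) + τ⁻¹ * τ ^ 2 := by gcongr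
    _ = τ * ((∫ t in (0 : ℝ)..1, ‖v t‖) + 1) := by field_simp

/-! ### The Dirac system -/

/-- The second-order approximation of `e^{-iμx} y₁(x)`. -/
noncomputable def diracApprox (σ : ℝ → ℂ) (μ : ℂ) (x : ℝ) : ℂ :=
  1 + upperInt (2 * I * μ) σ x - lowerInt 0 (fun t => σ t * upperInt (2 * I * μ) σ t) x
    - upperInt (2 * I * μ) (fun t => σ t *
        lowerInt 0 (fun s => σ s * upperInt (2 * I * μ) σ s) t) x
    + I / (2 * μ) * (-(lowerInt (2 * I * μ) σ x * upperInt (2 * I * μ) (fun t => σ t ^ 2) x)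
        + upperInt (2 * I * μ) (fun t => σ t ^ 2) x
        + upperInt (2 * I * μ) σ x * lowerInt 0 (fun t => σ t ^ 2) x
        + lowerInt 0 (fun t => σ t ^ 2) x)

/-- Solutions of the integral equations equivalent to the Dirac system, with asymptotics. -/
theorem exists_dirac_solution {σ : ℝ → ℂ} (hσ : IntervalIntegrable σ volume 0 1)
    (hσ2 : IntervalIntegrable (fun t => σ t ^ 2) volume 0 1) {r : ℝ} (hr : 0 ≤ r) :
    ∃ R > (0 : ℝ), ∃ C > (0 : ℝ), ∀ μ ∈ halfPlane r, R < ‖μ‖ →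
      ∃ a b : C(Icc (0 : ℝ) 1, ℂ), ∀ x ∈ Icc (0 : ℝ) 1,
        extend a x = 1 - lowerInt 0 (fun t => σ t * extend b t) x
          + I / (2 * μ) * lowerInt 0 (fun t => σ t ^ 2 * extend (a + b) t) x ∧
        extend b x = upperInt (2 * I * μ) (fun t => σ t * extend a t) x
          + I / (2 * μ) * upperInt (2 * I * μ) (fun t => σ t ^ 2 * extend (a + b) t) x ∧
        ‖extend a x + extend b x - diracApprox σ μ x‖ ≤ C * rho σ μ := by
  set c := Real.exp (2 * r) with hc
  have hc1 : 1 ≤ c := Real.one_le_exp (by positivity)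
  set N₁ := ∫ t in (0 : ℝ)..1, ‖σ t‖ with hN₁
  set N₂ := ∫ t in (0 : ℝ)..1, ‖σ t ^ 2‖ with hN₂
  have hN₁0 : 0 ≤ N₁ := intervalIntegral.integral_nonneg zero_le_one fun _ _ => norm_nonneg _
  have hN₂0 : 0 ≤ N₂ := intervalIntegral.integral_nonneg zero_le_one fun _ _ => norm_nonneg _
  set M := c * (N₁ + N₂ + 1) with hMdef
  have hM : 1 ≤ M := by nlinarith
  have hM0 : 0 < M := by linarith
  have hcM : c ≤ M := by nlinarith
  have hcN₁ : c * N₁ ≤ M := by rw [hMdef]; gcongr; linarith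
  have hcN₂ : c * N₂ ≤ M := by rw [hMdef]; gcongr; linarith
  have hcN₁' : c * (N₁ + 1) ≤ M := by rw [hMdef]; gcongr; linarith
  -- The largest value the abstract solvability lemma allows. Below, `‖h‖ ≤ η/(2M)` gives `‖T V f‖ ≤
  -- η‖f‖`, and `|μ| > 1/η` gives `|ε| ≤ η`.
  set η := 1 / (14 * M ^ 3) with hη
  have hη0 : 0 < η := by positivity
  obtain ⟨R₀, hR₀, hRL⟩ := exists_norm_upperInt_le hσ hr (η := η / (2 * M)) (by positivity)
  -- The constant is the stability factor `6 M²` times two residuals of size `11 M³ ρ`.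
  refine ⟨max R₀ (1 / η), lt_max_of_lt_left hR₀, 6 * M ^ 2 * (22 * M ^ 3), by positivity,
    fun μ hμ hRμ => ?_⟩
  have hμη : 1 / η < ‖μ‖ := lt_of_le_of_lt (le_max_right _ _) hRμ
  have hμ0 : 0 < ‖μ‖ := lt_trans (by positivity) hμη
  have hl := ExpBound.of_mem_halfPlane hr hμ
  have h0 := expBound_zero hc1
  set l := 2 * I * μ with hldef
  let V := lowerOp h0 hσ
  let T := upperOp hl hσ
  let S := lowerOp h0 hσ2
  let S' := upperOp hl hσ2
  let g := lowerOp hl hσ 1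
  let h := upperOp hl hσ 1
  set ε : ℂ := I / (2 * μ) with hεdef
  obtain ⟨ρg, ρh, ρgg, ρhh, ρμ⟩ := rho_lower_bounds hσ hσ2 μ
  have hρ : 0 < rho σ μ := lt_of_lt_of_le (by positivity) ρμ
  set τ := Real.sqrt (rho σ μ) with hτdef
  have hτ : 0 < τ := Real.sqrt_pos.2 hρ
  have hτ2 : τ ^ 2 = rho σ μ := Real.sq_sqrt hρ.le
  have eg : ∀ t ∈ Icc (0 : ℝ) 1, extend g t = lowerInt l σ t := fun t ht => by
    rw [extend_of_mem _ ht, lowerOp_one_apply]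
  have eh : ∀ t ∈ Icc (0 : ℝ) 1, extend h t = upperInt l σ t := fun t ht => by
    rw [extend_of_mem _ ht, upperOp_one_apply]
  have icongr : ∀ (u v : ℝ → ℝ), (∀ t ∈ Icc (0 : ℝ) 1, u t = v t) →
      ∫ t in (0 : ℝ)..1, u t = ∫ t in (0 : ℝ)..1, v t := fun u v huv =>
    intervalIntegral.integral_congr fun t ht => huv t (by simpa using ht)
  have εnorm : ‖ε‖ = ‖μ‖⁻¹ / 2 := by
    rw [hεdef, norm_div, norm_mul, Complex.norm_I, Complex.norm_two]; field_simp
  have εle : ‖ε‖ ≤ ‖μ‖⁻¹ := by rw [εnorm]; linarith [inv_pos.2 hμ0]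
  have ετ : ‖ε‖ ≤ τ := εle.trans (Real.le_sqrt_of_sq_le (by rw [inv_pow]; exact ρμ))
  have εη : ‖ε‖ ≤ η := εle.trans (by
    rw [inv_le_comm₀ hμ0 hη0, ← one_div]; exact hμη.le)
  have nV : ‖V‖ ≤ M := (opNorm_lowerOp_le h0 hσ).trans hcN₁
  have nT : ‖T‖ ≤ M := (opNorm_upperOp_le hl hσ).trans hcN₁
  have nS : ‖S‖ ≤ M := (opNorm_lowerOp_le h0 hσ2).trans hcN₂
  have nS' : ‖S'‖ ≤ M := (opNorm_upperOp_le hl hσ2).trans hcN₂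
  have ng : ‖g‖ ≤ M := by
    refine (norm_lowerOp_le hl hσ 1).trans ?_
    simpa using hcN₁
  have nh : ‖h‖ ≤ M := by
    refine (norm_upperOp_le hl hσ 1).trans ?_
    simpa using hcN₁
  have hsup : ‖h‖ ≤ η / (2 * M) := (ContinuousMap.norm_le _ (by positivity)).2 fun x => by
    rw [upperOp_one_apply]
    exact hRL μ hμ (lt_of_le_of_lt (le_max_left _ _) hRμ) x x.2
  have iTV : ∀ f, T (V f) = V f * h + T (f * h) := fun f => upperOp_lowerOp hl hσ hσ f h0
  have iTS : T (S 1) = S 1 * h + S' h := by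
    simpa using upperOp_lowerOp hl hσ hσ2 1 h0
  have iVS : V (S' 1) = g * S' 1 + S g := lowerOp_upperOp_one hl hσ hσ2 h0
  have nTV : ∀ f, ‖T (V f)‖ ≤ η * ‖f‖ := fun f => by
    rw [iTV]
    calc ‖V f * h + T (f * h)‖ ≤ M * ‖f‖ * (η / (2 * M)) + M * (‖f‖ * (η / (2 * M))) := by
          refine (norm_add_le _ _).trans (add_le_add ?_ ?_)
          · exact (norm_mul_le _ _).trans (by gcongr; exact V.le_of_opNorm_le nV f)
          · refine (T.le_of_opNorm_le nT _).trans ?_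
            gcongr
            exact (norm_mul_le _ _).trans (by gcongr)
      _ = η * ‖f‖ := by field_simp; ring
  have sqh : ∫ t in (0 : ℝ)..1, ‖σ t‖ * ‖extend h t‖ ^ 2 ≤ τ ^ 2 := by
    rw [hτ2]
    exact (icongr _ _ fun t ht => by rw [eh t ht]).trans_le ρhh
  have sqg : ∫ t in (0 : ℝ)..1, ‖σ t‖ * ‖extend g t‖ ^ 2 ≤ τ ^ 2 := by
    rw [hτ2]
    exact (icongr _ _ fun t ht => by rw [eg t ht]).trans_le ρgg
  have nVh : ∀ f, ‖V (f * h)‖ ≤ ‖f‖ * (M * τ) := fun f => by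
    calc ‖V (f * h)‖ ≤ c * (‖f‖ * (τ * (N₁ + 1))) := by
          refine (norm_lowerOp_le h0 hσ _).trans ?_
          gcongr
          refine (integral_norm_mul_extend_mul_le hσ f h).trans ?_
          gcongr
          exact integral_norm_mul_le_of_sq hσ h hτ sqh
      _ = ‖f‖ * (c * (N₁ + 1) * τ) := by ring
      _ ≤ ‖f‖ * (M * τ) := by gcongr
  have nTg : ∀ f, ‖T (f * g)‖ ≤ ‖f‖ * (M * τ) := fun f => by
    calc ‖T (f * g)‖ ≤ c * (‖f‖ * (τ * (N₁ + 1))) := by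
          refine (norm_upperOp_le hl hσ _).trans ?_
          gcongr
          refine (integral_norm_mul_extend_mul_le hσ f g).trans ?_
          gcongr
          exact integral_norm_mul_le_of_sq hσ g hτ sqg
      _ = ‖f‖ * (c * (N₁ + 1) * τ) := by ring
      _ ≤ ‖f‖ * (M * τ) := by gcongr
  have nThh : ‖T (h * h)‖ ≤ M * τ ^ 2 := by
    calc ‖T (h * h)‖ ≤ c * τ ^ 2 := by
          refine (norm_upperOp_le hl hσ _).trans ?_
          gcongr
          refine (icongr _ _ fun t ht => ?_).trans_le sqh
          rw [extend_mul, norm_mul, norm_mul, sq]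
      _ ≤ M * τ ^ 2 := by gcongr
  have nS2 : ∀ (f : C(Icc (0 : ℝ) 1, ℂ)) (q : ℝ → ℂ), (∀ t ∈ Icc (0 : ℝ) 1, extend f t = q t) →
      ‖μ‖⁻¹ * (∫ t in (0 : ℝ)..1, ‖σ t ^ 2 * q t‖) ≤ rho σ μ →
      ‖ε‖ * (c * ∫ t in (0 : ℝ)..1, ‖σ t ^ 2 * extend f t‖) ≤ M * τ ^ 2 := by
    intro f q hq hle
    have e : ∫ t in (0 : ℝ)..1, ‖σ t ^ 2 * extend f t‖ = ∫ t in (0 : ℝ)..1, ‖σ t ^ 2 * q t‖ :=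
      icongr _ _ fun t ht => by rw [hq t ht]
    have nn : 0 ≤ ∫ t in (0 : ℝ)..1, ‖σ t ^ 2 * q t‖ :=
      intervalIntegral.integral_nonneg zero_le_one fun _ _ => norm_nonneg _
    rw [e, hτ2]
    calc _ ≤ ‖μ‖⁻¹ * (c * ∫ t in (0 : ℝ)..1, ‖σ t ^ 2 * q t‖) := by gcongr
      _ = c * (‖μ‖⁻¹ * ∫ t in (0 : ℝ)..1, ‖σ t ^ 2 * q t‖) := by ring
      _ ≤ M * rho σ μ := by gcongr
  have nSh : ‖ε‖ * ‖S h‖ ≤ M * τ ^ 2 :=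
    le_trans (by gcongr; exact norm_lowerOp_le h0 hσ2 h) (nS2 h _ eh ρh)
  have nSh' : ‖ε‖ * ‖S' h‖ ≤ M * τ ^ 2 :=
    le_trans (by gcongr; exact norm_upperOp_le hl hσ2 h) (nS2 h _ eh ρh)
  have nSg : ‖ε‖ * ‖S g‖ ≤ M * τ ^ 2 :=
    le_trans (by gcongr; exact norm_lowerOp_le h0 hσ2 g) (nS2 g _ eg ρg)
  obtain ⟨ra, rb⟩ := norm_residual_le (V := V) (T := T) (S := S) (S' := S') (g := g) (h := h)
    hM nV nT nS nS' ng nh rfl (iTV h) iTS iVS ετ nVh nTg nThh nSh nSg nSh' rfl rfl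
  set a₀ := 1 - V h + ε • (S 1 - g * S' 1)
  set b₀ := h - T (V h) + ε • (S' 1 + S 1 * h)
  obtain ⟨a, b, eqa, eqb, hab⟩ := exists_solution_near hM nV nT nS nS' nTV εη
    (by rw [hη]; field_simp; exact le_rfl) 1 a₀ b₀
  have eVh : ∀ t ∈ Icc (0 : ℝ) 1,
      extend (V h) t = lowerInt 0 (fun s => σ s * upperInt l σ s) t := fun t ht => by
    rw [extend_of_mem _ ht, lowerOp_apply]
    exact lowerInt_congr (fun s hs => by rw [eh s hs]) ht
  refine ⟨a, b, fun x hx => ⟨?_, ?_, ?_⟩⟩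
  · have := congrArg (fun f : C(Icc (0 : ℝ) 1, ℂ) => f ⟨x, hx⟩) eqa
    rw [extend_of_mem _ hx]
    exact this
  · have := congrArg (fun f : C(Icc (0 : ℝ) 1, ℂ) => f ⟨x, hx⟩) eqb
    rw [extend_of_mem _ hx]
    exact this
  · have eTVh : T (V h) ⟨x, hx⟩ = upperInt l (fun t => σ t *
        lowerInt 0 (fun s => σ s * upperInt l σ s) t) x := by
      rw [upperOp_apply]
      exact upperInt_congr (fun t ht => by rw [eVh t ht]) hx
    have h₀ : a₀ ⟨x, hx⟩ + b₀ ⟨x, hx⟩ = diracApprox σ μ x := by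
      have e1 : a₀ ⟨x, hx⟩ = 1 - V h ⟨x, hx⟩
          + ε * (S 1 ⟨x, hx⟩ - g ⟨x, hx⟩ * S' 1 ⟨x, hx⟩) := rfl
      have e2 : b₀ ⟨x, hx⟩ = h ⟨x, hx⟩ - T (V h) ⟨x, hx⟩
          + ε * (S' 1 ⟨x, hx⟩ + S 1 ⟨x, hx⟩ * h ⟨x, hx⟩) := rfl
      rw [e1, e2, eTVh, ← extend_of_mem (V h) hx, eVh x hx, ← extend_of_mem g hx, eg x hx,
        ← extend_of_mem h hx, eh x hx, lowerOp_one_apply, upperOp_one_apply, diracApprox]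
      ring
    have e3 : extend a x + extend b x - diracApprox σ μ x =
        (a - a₀) ⟨x, hx⟩ + (b - b₀) ⟨x, hx⟩ := by
      rw [← h₀, extend_of_mem a hx, extend_of_mem b hx]
      exact add_sub_add_comm _ _ _ _
    rw [e3]
    calc _ ≤ ‖a - a₀‖ + ‖b - b₀‖ := (norm_add_le _ _).trans
          (add_le_add ((a - a₀).norm_coe_le_norm _) ((b - b₀).norm_coe_le_norm _))
      _ ≤ 6 * M ^ 2 * (11 * M ^ 3 * τ ^ 2 + 11 * M ^ 3 * τ ^ 2) := hab.trans (by gcongr)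
      _ = 6 * M ^ 2 * (22 * M ^ 3) * rho σ μ := by rw [hτ2]; ring

/-- Passing from the Dirac system to the Sturm-Liouville equation. -/
theorem isSolution_of_dirac {σ A B : ℝ → ℂ} {μ ε : ℂ} (hε : 2 * μ * ε = I)
    (hA : IsACPrimitive A fun x => -σ x * B x + ε * (σ x ^ 2 * (A x + B x)))
    (hB : IsACPrimitive B fun x =>
      -(2 * I * μ) * B x - σ x * A x - ε * (σ x ^ 2 * (A x + B x))) :
    IsSolution σ μ (fun x => cexp (I * μ * x) * (A x + B x))
      (fun x => I * μ * (cexp (I * μ * x) * (A x - B x))) := by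
  have he := isACPrimitive_cexp (I * μ)
  -- The `ε` terms cancel in `(A + B)'` and double in `(A - B)'`; there `iμ · 2ε = -1` produces
  -- exactly `-σ² y`.
  have hy := (he.mul (hA.add hB)).congr (f' := fun x =>
    I * μ * (cexp (I * μ * x) * (A x - B x)) - σ x * (cexp (I * μ * x) * (A x + B x)))
    fun x _ => by ring
  have hu := ((he.mul (hA.sub hB)).const_mul (I * μ)).congr (f' := fun x =>
    σ x * (I * μ * (cexp (I * μ * x) * (A x - B x))) -
      σ x ^ 2 * (cexp (I * μ * x) * (A x + B x)) - μ ^ 2 * (cexp (I * μ * x) * (A x + B x)))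
    fun x _ => by
      linear_combination (I * cexp (I * μ * x) * σ x ^ 2 * (A x + B x)) * hε +
        (cexp (I * μ * x) * (A x + B x) * (σ x ^ 2 + μ ^ 2)) * I_sq
  exact ⟨hy.ac, hu.ac, (ae_restrict_iff' measurableSet_Icc).2 hy.ae_hasDerivAt,
    (ae_restrict_iff' measurableSet_Icc).2 hu.ae_hasDerivAt⟩

theorem diracFst_mul {μ : ℂ} (hμ : μ ≠ 0) (A B e : ℝ → ℂ) (x : ℝ) :
    diracFst μ (fun x => e x * (A x + B x)) (fun x => I * μ * (e x * (A x - B x))) x =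
      e x * A x := by
  have : I * μ ≠ 0 := mul_ne_zero I_ne_zero hμ
  rw [diracFst, mul_div_cancel_left₀ _ this]
  ring

theorem diracSnd_mul {μ : ℂ} (hμ : μ ≠ 0) (A B e : ℝ → ℂ) (x : ℝ) :
    diracSnd μ (fun x => e x * (A x + B x)) (fun x => I * μ * (e x * (A x - B x))) x =
      e x * B x := by
  have : I * μ ≠ 0 := mul_ne_zero I_ne_zero hμ
  rw [diracSnd, mul_div_cancel_left₀ _ this]
  ring

/-- The solution with `d₁(0) = 1`, `d₂(1) = 0` and its asymptotics. -/
theorem exists_solution_first {σ : ℝ → ℂ} (hσ : IntervalIntegrable σ volume 0 1)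
    (hσ2 : IntervalIntegrable (fun t => σ t ^ 2) volume 0 1) {r : ℝ} (hr : 0 ≤ r) :
    ∃ R > (0 : ℝ), ∃ C > (0 : ℝ), ∀ μ ∈ halfPlane r, R < ‖μ‖ →
      ∃ y u : ℝ → ℂ, IsSolution σ μ y u ∧ diracFst μ y u 0 = 1 ∧ diracSnd μ y u 1 = 0 ∧
        ∀ x ∈ Icc (0 : ℝ) 1,
          ‖y x - cexp (I * μ * x) * diracApprox σ μ x‖ ≤ C * rho σ μ := by
  obtain ⟨R, hR, C, hC, H⟩ := exists_dirac_solution hσ hσ2 hr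
  refine ⟨R, hR, Real.exp r * C, by positivity, fun μ hμ hRμ => ?_⟩
  obtain ⟨a, b, hab⟩ := H μ hμ hRμ
  have hμ0 : μ ≠ 0 := norm_pos_iff.1 (hR.trans hRμ)
  -- The right-hand sides of the integral equations are used in place of the fixed point: they agree
  -- with it on `[0,1]` and are explicit primitives.
  set A : ℝ → ℂ := fun x => 1 - lowerInt 0 (fun t => σ t * extend b t) x
          + I / (2 * μ) * lowerInt 0 (fun t => σ t ^ 2 * extend (a + b) t) x with hA
  set B : ℝ → ℂ := fun x => upperInt (2 * I * μ) (fun t => σ t * extend a t) x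
          + I / (2 * μ) * upperInt (2 * I * μ) (fun t => σ t ^ 2 * extend (a + b) t) x with hB
  have eA : ∀ x ∈ Icc (0 : ℝ) 1, extend a x = A x := fun x hx => (hab x hx).1
  have eB : ∀ x ∈ Icc (0 : ℝ) 1, extend b x = B x := fun x hx => (hab x hx).2.1
  have hi := IntervalIntegrable.mul_extend hσ2 (a + b)
  refine ⟨fun x => cexp (I * μ * x) * (A x + B x),
    fun x => I * μ * (cexp (I * μ * x) * (A x - B x)), ?_, ?_, ?_, fun x hx => ?_⟩
  · refine isSolution_of_dirac (ε := I / (2 * μ)) (by field_simp) ?_ ?_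
    · refine (((IsACPrimitive.const 1).sub (isACPrimitive_lowerInt 0
        (IntervalIntegrable.mul_extend hσ b))).add
        ((isACPrimitive_lowerInt 0 hi).const_mul (I / (2 * μ)))).congr fun x hx => ?_
      rw [extend_add, eA x hx, eB x hx]
      ring
    · refine ((isACPrimitive_upperInt (2 * I * μ) (IntervalIntegrable.mul_extend hσ a)).add
        ((isACPrimitive_upperInt (2 * I * μ) hi).const_mul (I / (2 * μ)))).congr fun x hx => ?_
      rw [extend_add, eA x hx, eB x hx, hB]
      ring
  · rw [diracFst_mul hμ0]
    simp [hA]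
  · rw [diracSnd_mul hμ0]
    simp [hB]
  · have h3 := (hab x hx).2.2
    rw [eA x hx, eB x hx] at h3
    have he : ‖cexp (I * μ * x)‖ ≤ Real.exp r := by
      rw [Complex.norm_exp]
      have hμ' : -r < μ.im := hμ
      have : (I * μ * (x : ℂ)).re = -μ.im * x := by simp
      rw [this]
      exact Real.exp_le_exp.2 (by nlinarith [hx.1, hx.2])
    rw [← mul_sub, norm_mul, mul_assoc (Real.exp r)]
    gcongr

/-! ### Reflection `x ↦ 1 - x` -/

/-- The potential of the reflected equation. -/
def reflect (σ : ℝ → ℂ) (t : ℝ) : ℂ := -σ (1 - t)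

theorem one_sub_mem {x : ℝ} (hx : x ∈ Icc (0 : ℝ) 1) : 1 - x ∈ Icc (0 : ℝ) 1 :=
  ⟨by linarith [hx.2], by linarith [hx.1]⟩

theorem lowerInt_comp_one_sub (l : ℂ) (w : ℝ → ℂ) (x : ℝ) :
    lowerInt l (fun t => w (1 - t)) x = upperInt l w (1 - x) := by
  have h := intervalIntegral.integral_comp_sub_left (a := 0) (b := x)
    (fun s : ℝ => cexp (l * ((s : ℂ) - (1 - x : ℝ))) * w s) 1
  rw [sub_zero] at h
  rw [upperInt, ← h, lowerInt]
  refine intervalIntegral.integral_congr fun t _ => ?_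
  push_cast
  ring_nf

theorem upperInt_comp_one_sub (l : ℂ) (w : ℝ → ℂ) (x : ℝ) :
    upperInt l (fun t => w (1 - t)) x = lowerInt l w (1 - x) := by
  have h := lowerInt_comp_one_sub l (fun t => w (1 - t)) (1 - x)
  simpa using h.symm

theorem absolutelyContinuousOnInterval_comp_one_sub {f : ℝ → ℂ}
    (hf : AbsolutelyContinuousOnInterval f 0 1) :
    AbsolutelyContinuousOnInterval (fun x => f (1 - x)) 0 1 := by
  rw [absolutelyContinuousOnInterval_iff] at hf ⊢
  intro ε hε
  obtain ⟨δ, hδ, H⟩ := hf ε hε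
  refine ⟨δ, hδ, fun E hE hlen => ?_⟩
  -- The reflected intervals are again disjoint, lie in `[0,1]` and have the same lengths.
  refine H (E.1, fun i => (1 - (E.2 i).1, 1 - (E.2 i).2)) ⟨fun i hi => ?_, ?_⟩ ?_
  · have h := hE.1 i hi
    rw [uIcc_of_le zero_le_one] at h ⊢
    exact ⟨one_sub_mem h.1, one_sub_mem h.2⟩
  · intro i hi j hj hij
    have h := hE.2 hi hj hij
    simp only [Function.onFun, uIoc, Ioc_disjoint_Ioc] at h ⊢
    grind
  · refine lt_of_eq_of_lt (Finset.sum_congr rfl fun i _ => ?_) hlen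
    simp only [Real.dist_eq]
    rw [sub_sub_sub_cancel_left, abs_sub_comm]

theorem ae_one_sub {p : ℝ → Prop} (h : ∀ᵐ x, x ∈ Icc (0 : ℝ) 1 → p x) :
    ∀ᵐ x, x ∈ Icc (0 : ℝ) 1 → p (1 - x) := by
  have := (Measure.measurePreserving_sub_left volume (1 : ℝ)).quasiMeasurePreserving.ae h
  filter_upwards [this] with x hx hxI
  exact hx (one_sub_mem hxI)

theorem hasDerivAt_comp_one_sub {f : ℝ → ℂ} {f' : ℂ} {x : ℝ} (h : HasDerivAt f f' (1 - x)) :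
    HasDerivAt (fun t => f (1 - t)) (-f') x :=
  h.comp_const_sub 1 x

/-- Reflection maps solutions to solutions. -/
theorem IsSolution.reflect {σ : ℝ → ℂ} {μ : ℂ} {y u : ℝ → ℂ}
    (h : IsSolution (reflect σ) μ y u) :
    IsSolution σ μ (fun x => y (1 - x)) (fun x => -u (1 - x)) where
  ac := absolutelyContinuousOnInterval_comp_one_sub h.ac
  ac_quasi := (absolutelyContinuousOnInterval_comp_one_sub h.ac_quasi).fun_neg
  deriv_eq := by
    have h1 := ae_one_sub ((ae_restrict_iff' measurableSet_Icc).1 h.deriv_eq)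
    rw [ae_restrict_iff' measurableSet_Icc]
    filter_upwards [h1] with x hx hxI
    -- Reflection reverses the sign of `y'`; the minus signs in `reflect σ` and in `-u` compensate
    -- for it.
    refine (hasDerivAt_comp_one_sub (hx hxI)).congr_deriv ?_
    simp only [SturmLiouville.reflect, sub_sub_cancel]
    ring
  quasi_deriv_eq := by
    have h1 := ae_one_sub ((ae_restrict_iff' measurableSet_Icc).1 h.quasi_deriv_eq)
    rw [ae_restrict_iff' measurableSet_Icc]
    filter_upwards [h1] with x hx hxI
    refine (hasDerivAt_comp_one_sub (hx hxI)).fun_neg.congr_deriv ?_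
    simp only [SturmLiouville.reflect, sub_sub_cancel]
    ring

theorem upperInt_neg (l : ℂ) (w : ℝ → ℂ) (x : ℝ) :
    upperInt l (fun t => -w t) x = -upperInt l w x := by
  simpa using upperInt_const_mul l (-1) w x

theorem lowerInt_neg (l : ℂ) (w : ℝ → ℂ) (x : ℝ) :
    lowerInt l (fun t => -w t) x = -lowerInt l w x := by
  simpa using lowerInt_const_mul l (-1) w x

theorem upperInt_reflect (l : ℂ) (σ : ℝ → ℂ) (x : ℝ) :
    upperInt l (reflect σ) x = -lowerInt l σ (1 - x) := by
  rw [← upperInt_comp_one_sub, ← upperInt_neg]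
  rfl

theorem lowerInt_reflect (l : ℂ) (σ : ℝ → ℂ) (x : ℝ) :
    lowerInt l (reflect σ) x = -upperInt l σ (1 - x) := by
  rw [← lowerInt_comp_one_sub, ← lowerInt_neg]
  rfl

theorem integral_zero_one_comp_one_sub (f : ℝ → ℝ) :
    ∫ t in (0 : ℝ)..1, f (1 - t) = ∫ t in (0 : ℝ)..1, f t := by
  simp

/-- Reflection exchanges `|g|` and `|h|`, and `ρ` is symmetric in them, so the error bound transfers
to the second solution unchanged. -/
theorem rho_reflect (σ : ℝ → ℂ) (μ : ℂ) : rho (reflect σ) μ = rho σ μ := by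
  rw [rho_eq, rho_eq]
  simp only [upperInt_reflect, lowerInt_reflect, norm_neg, reflect, neg_sq]
  rw [integral_zero_one_comp_one_sub fun t => ‖σ t ^ 2‖ *
      (‖upperInt (2 * I * μ) σ t‖ + ‖lowerInt (2 * I * μ) σ t‖),
    integral_zero_one_comp_one_sub fun t => ‖upperInt (2 * I * μ) σ t‖ ^ 2,
    integral_zero_one_comp_one_sub fun t => ‖lowerInt (2 * I * μ) σ t‖ ^ 2,
    integral_zero_one_comp_one_sub fun t => ‖σ t‖ * ‖upperInt (2 * I * μ) σ t‖ ^ 2,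
    integral_zero_one_comp_one_sub fun t => ‖σ t‖ * ‖lowerInt (2 * I * μ) σ t‖ ^ 2]
  simp only [add_comm ‖upperInt (2 * I * μ) σ _‖]
  ring

/-- Upper and lower integrals trade places and each factor `σ` contributes a sign, so precisely the
terms of odd degree in `σ` change sign. -/
theorem diracApprox_reflect (σ : ℝ → ℂ) (μ : ℂ) (x : ℝ) :
    diracApprox (reflect σ) μ (1 - x) =
      1 - lowerInt (2 * I * μ) σ x - upperInt 0 (fun t => σ t * lowerInt (2 * I * μ) σ t) x
        + lowerInt (2 * I * μ) (fun t => σ t *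
            upperInt 0 (fun s => σ s * lowerInt (2 * I * μ) σ s) t) x
        + I / (2 * μ) * (lowerInt (2 * I * μ) (fun t => σ t ^ 2) x
            + upperInt (2 * I * μ) σ x * lowerInt (2 * I * μ) (fun t => σ t ^ 2) x
            - lowerInt (2 * I * μ) σ x * upperInt 0 (fun t => σ t ^ 2) x
            + upperInt 0 (fun t => σ t ^ 2) x) := by
  have h1 : ∀ t, lowerInt 0 (fun s => reflect σ s * upperInt (2 * I * μ) (reflect σ) s) t =
      upperInt 0 (fun s => σ s * lowerInt (2 * I * μ) σ s) (1 - t) := fun t => by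
    rw [← lowerInt_comp_one_sub]
    simp only [upperInt_reflect, reflect, neg_mul_neg]
  have h2 : upperInt (2 * I * μ) (fun t => reflect σ t *
        lowerInt 0 (fun s => reflect σ s * upperInt (2 * I * μ) (reflect σ) s) t) (1 - x) =
      -lowerInt (2 * I * μ) (fun t => σ t *
        upperInt 0 (fun s => σ s * lowerInt (2 * I * μ) σ s) t) x := by
    have h := upperInt_comp_one_sub (2 * I * μ) (fun t => σ t *
        upperInt 0 (fun s => σ s * lowerInt (2 * I * μ) σ s) t) (1 - x)
    rw [sub_sub_cancel] at h
    rw [← h, ← upperInt_neg]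
    simp only [h1]
    simp only [reflect, neg_mul]
  have h3 : ∀ l, lowerInt l (fun t => reflect σ t ^ 2) (1 - x) =
      upperInt l (fun t => σ t ^ 2) x := fun l => by
    have h := lowerInt_comp_one_sub l (fun t => σ t ^ 2) (1 - x)
    rw [sub_sub_cancel] at h
    rw [← h]
    simp only [reflect, neg_sq]
  have h4 : ∀ l, upperInt l (fun t => reflect σ t ^ 2) (1 - x) =
      lowerInt l (fun t => σ t ^ 2) x := fun l => by
    have h := upperInt_comp_one_sub l (fun t => σ t ^ 2) (1 - x)
    rw [sub_sub_cancel] at h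
    rw [← h]
    simp only [reflect, neg_sq]
  rw [diracApprox, h2, h1, h3, h4, upperInt_reflect, lowerInt_reflect, sub_sub_cancel]
  ring

/-! ### Linear independence -/

/-- A linear relation between solutions carries over to the quasi-derivatives. -/
theorem IsSolution.quasi_relation {σ : ℝ → ℂ} {μ : ℂ} {y₁ u₁ y₂ u₂ : ℝ → ℂ}
    (h₁ : IsSolution σ μ y₁ u₁) (h₂ : IsSolution σ μ y₂ u₂) {c₁ c₂ : ℂ}
    (h : ∀ x ∈ Icc (0 : ℝ) 1, c₁ * y₁ x + c₂ * y₂ x = 0) :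
    ∀ x ∈ Icc (0 : ℝ) 1, c₁ * u₁ x + c₂ * u₂ x = 0 := by
  have hcont : ContinuousOn (fun x => c₁ * u₁ x + c₂ * u₂ x) (Icc 0 1) := by
    have e₁ : ContinuousOn u₁ (Icc 0 1) := by simpa using h₁.ac_quasi.continuousOn
    have e₂ : ContinuousOn u₂ (Icc 0 1) := by simpa using h₂.ac_quasi.continuousOn
    fun_prop
  have hae : (fun x => c₁ * u₁ x + c₂ * u₂ x) =ᵐ[volume.restrict (Icc (0 : ℝ) 1)] fun _ => 0 := by
    -- The relation is known only on `[0,1]`, so it can be differentiated only at interior points;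
    -- continuity of `u₁`, `u₂` recovers the rest.
    have hend : ∀ᵐ x : ℝ, x ≠ 0 ∧ x ≠ 1 :=
      (Measure.ae_ne volume 0).and (Measure.ae_ne volume 1)
    filter_upwards [h₁.deriv_eq, h₂.deriv_eq, ae_restrict_mem measurableSet_Icc,
      ae_restrict_of_ae hend] with x d₁ d₂ hx hne
    have hmem : Icc (0 : ℝ) 1 ∈ nhds x :=
      Icc_mem_nhds (lt_of_le_of_ne hx.1 hne.1.symm) (lt_of_le_of_ne hx.2 hne.2)
    have hd := (d₁.const_mul c₁).add (d₂.const_mul c₂)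
    have h0 : HasDerivAt (fun t => c₁ * y₁ t + c₂ * y₂ t) 0 x :=
      (hasDerivAt_const x (0 : ℂ)).congr_of_eventuallyEq (by
        filter_upwards [hmem] with t ht using h t ht)
    have := hd.unique h0
    linear_combination this + σ x * h x hx
  exact MeasureTheory.Measure.eqOn_Icc_of_ae_eq volume zero_ne_one hae hcont continuousOn_const

/-- The functionals `d₁(0)` and `d₂(1)` take the values of the identity matrix on the pair. They
involve `u` as well as `y`, hence the need for `quasi_relation`. -/
theorem IsSolution.linearIndependent {σ : ℝ → ℂ} {μ : ℂ} {y₁ u₁ y₂ u₂ : ℝ → ℂ}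
    (h₁ : IsSolution σ μ y₁ u₁) (h₂ : IsSolution σ μ y₂ u₂)
    (b₁₀ : diracFst μ y₁ u₁ 0 = 1) (b₁₁ : diracSnd μ y₁ u₁ 1 = 0)
    (b₂₀ : diracFst μ y₂ u₂ 0 = 0) (b₂₁ : diracSnd μ y₂ u₂ 1 = 1) :
    LinearIndependent ℂ ![(Icc (0 : ℝ) 1).domRestrict y₁, (Icc (0 : ℝ) 1).domRestrict y₂] := by
  rw [LinearIndependent.pair_iff]
  intro c₁ c₂ hc
  have hy : ∀ x ∈ Icc (0 : ℝ) 1, c₁ * y₁ x + c₂ * y₂ x = 0 := fun x hx =>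
    congrFun hc ⟨x, hx⟩
  have hu := h₁.quasi_relation h₂ hy
  have y0 := hy 0 (by simp)
  have u0 := hu 0 (by simp)
  have y1 := hy 1 (by simp)
  have u1 := hu 1 (by simp)
  rw [diracFst] at b₁₀ b₂₀
  rw [diracSnd] at b₁₁ b₂₁
  constructor
  · linear_combination y0 / 2 + u0 / (2 * (I * μ)) - c₁ * b₁₀ - c₂ * b₂₀
  · linear_combination y1 / 2 - u1 / (2 * (I * μ)) - c₁ * b₁₁ - c₂ * b₂₁

/-! ### The asymptotic formulas in expanded form -/

theorem upperInt_zero_left (w : ℝ → ℂ) (x : ℝ) : upperInt 0 w x = ∫ t in x..1, w t := by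
  simp [upperInt]

theorem lowerInt_zero_left (w : ℝ → ℂ) (x : ℝ) : lowerInt 0 w x = ∫ t in (0 : ℝ)..x, w t := by
  simp [lowerInt]

theorem opK₁_unitFun (σ : ℝ → ℂ) (μ : ℂ) (x : ℝ) :
    opK₁ σ σ μ unitFun x = lowerInt 0 (fun t => σ t * upperInt (2 * I * μ) σ t) x := by
  simp only [lowerInt_zero_left, opK₁, unitFun, mul_one, upperInt]

theorem opK₂_unitFun (σ : ℝ → ℂ) (μ : ℂ) (x : ℝ) :
    opK₂ σ σ μ unitFun x = upperInt 0 (fun t => σ t * lowerInt (2 * I * μ) σ t) x := by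
  simp only [upperInt_zero_left, opK₂, unitFun, mul_one, lowerInt]

theorem cexp_mul_diracApprox (σ : ℝ → ℂ) (μ : ℂ) (x : ℝ) :
    cexp (I * μ * x) * diracApprox σ μ x =
      cexp (I * μ * x) *
          (1 + (∫ t in x..1, cexp (2 * I * μ * ((t : ℂ) - x)) * σ t)
            - ∫ t in (0 : ℝ)..x, σ t *
                ∫ s in t..1, cexp (2 * I * μ * ((s : ℂ) - t)) * σ s)
        - cexp (I * μ * x) *
            (∫ t in x..1, cexp (2 * I * μ * ((t : ℂ) - x)) * σ t * opK₁ σ σ μ unitFun t)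
        + I * cexp (I * μ * x) / (2 * μ) *
            (-((∫ t in (0 : ℝ)..x, cexp (2 * I * μ * ((x : ℂ) - t)) * σ t) *
                (∫ t in x..1, cexp (2 * I * μ * ((t : ℂ) - x)) * σ t ^ 2))
              + ∫ t in x..1, cexp (2 * I * μ * ((t : ℂ) - x)) * σ t ^ 2)
        + I * cexp (I * μ * x) / (2 * μ) *
            ((∫ t in x..1, cexp (2 * I * μ * ((t : ℂ) - x)) * σ t) *
                (∫ t in (0 : ℝ)..x, σ t ^ 2)
              + ∫ t in (0 : ℝ)..x, σ t ^ 2) := by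
  rw [diracApprox]
  simp only [← opK₁_unitFun]
  simp only [opK₁, unitFun, mul_one, upperInt, lowerInt, zero_mul, Complex.exp_zero, one_mul,
    ← mul_assoc]
  ring

theorem cexp_mul_diracApprox_reflect (σ : ℝ → ℂ) (μ : ℂ) (x : ℝ) :
    cexp (I * μ * (1 - x : ℝ)) * diracApprox (reflect σ) μ (1 - x) =
      cexp (I * μ * (1 - x)) *
          (1 - (∫ t in (0 : ℝ)..x, cexp (2 * I * μ * ((x : ℂ) - t)) * σ t)
            - ∫ t in x..1, σ t *
                ∫ s in (0 : ℝ)..t, cexp (2 * I * μ * ((t : ℂ) - s)) * σ s)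
        + cexp (I * μ * (1 - x)) *
            (∫ t in (0 : ℝ)..x, cexp (2 * I * μ * ((x : ℂ) - t)) * σ t * opK₂ σ σ μ unitFun t)
        + I * cexp (I * μ * (1 - x)) / (2 * μ) *
            ((∫ t in (0 : ℝ)..x, cexp (2 * I * μ * ((x : ℂ) - t)) * σ t ^ 2)
              + (∫ t in x..1, cexp (2 * I * μ * ((t : ℂ) - x)) * σ t) *
                (∫ t in (0 : ℝ)..x, cexp (2 * I * μ * ((x : ℂ) - t)) * σ t ^ 2))
        + I * cexp (I * μ * (1 - x)) / (2 * μ) *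
            (-((∫ t in (0 : ℝ)..x, cexp (2 * I * μ * ((x : ℂ) - t)) * σ t) *
                (∫ t in x..1, σ t ^ 2))
              + ∫ t in x..1, σ t ^ 2) := by
  rw [diracApprox_reflect]
  simp only [← opK₂_unitFun, ofReal_sub, ofReal_one]
  simp only [opK₂, unitFun, mul_one, upperInt, lowerInt, zero_mul, Complex.exp_zero, one_mul,
    ← mul_assoc]
  ring

end SturmLiouville

/-! ### Assembly of the fundamental system from `σ` and its reflection. -/

theorem mainTheorem7 (σ : ℝ → ℂ) (hσ : MemLp σ 2 (volume.restrict (Icc (0 : ℝ) 1)))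
    (r : ℝ) (hr : 0 ≤ r) :
    ∃ R > (0 : ℝ), ∃ C > (0 : ℝ), ∀ μ ∈ SturmLiouville.halfPlane r, R < ‖μ‖ →
      ∃ y₁ u₁ y₂ u₂ : ℝ → ℂ,
        SturmLiouville.IsSolution σ μ y₁ u₁ ∧
        SturmLiouville.IsSolution σ μ y₂ u₂ ∧
        SturmLiouville.diracFst μ y₁ u₁ 0 = 1 ∧ SturmLiouville.diracSnd μ y₁ u₁ 1 = 0 ∧
        SturmLiouville.diracFst μ y₂ u₂ 0 = 0 ∧ SturmLiouville.diracSnd μ y₂ u₂ 1 = 1 ∧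
        LinearIndependent ℂ ![(Icc (0 : ℝ) 1).domRestrict y₁, (Icc (0 : ℝ) 1).domRestrict y₂] ∧
        (∀ x ∈ Icc (0 : ℝ) 1,
          ‖y₁ x -
            (cexp (I * μ * x) *
                (1 + (∫ t in x..1, cexp (2 * I * μ * ((t : ℂ) - x)) * σ t)
                  - ∫ t in (0 : ℝ)..x, σ t *
                      ∫ s in t..1, cexp (2 * I * μ * ((s : ℂ) - t)) * σ s)
              - cexp (I * μ * x) *
                  (∫ t in x..1, cexp (2 * I * μ * ((t : ℂ) - x)) * σ t *
                    SturmLiouville.opK₁ σ σ μ SturmLiouville.unitFun t)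
              + I * cexp (I * μ * x) / (2 * μ) *
                  (-((∫ t in (0 : ℝ)..x, cexp (2 * I * μ * ((x : ℂ) - t)) * σ t) *
                      (∫ t in x..1, cexp (2 * I * μ * ((t : ℂ) - x)) * σ t ^ 2))
                    + ∫ t in x..1, cexp (2 * I * μ * ((t : ℂ) - x)) * σ t ^ 2)
              + I * cexp (I * μ * x) / (2 * μ) *
                  ((∫ t in x..1, cexp (2 * I * μ * ((t : ℂ) - x)) * σ t) *
                      (∫ t in (0 : ℝ)..x, σ t ^ 2)
                    + ∫ t in (0 : ℝ)..x, σ t ^ 2))‖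
            ≤ C * SturmLiouville.rho σ μ) ∧
        (∀ x ∈ Icc (0 : ℝ) 1,
          ‖y₂ x -
            (cexp (I * μ * (1 - x)) *
                (1 - (∫ t in (0 : ℝ)..x, cexp (2 * I * μ * ((x : ℂ) - t)) * σ t)
                  - ∫ t in x..1, σ t *
                      ∫ s in (0 : ℝ)..t, cexp (2 * I * μ * ((t : ℂ) - s)) * σ s)
              + cexp (I * μ * (1 - x)) *
                  (∫ t in (0 : ℝ)..x, cexp (2 * I * μ * ((x : ℂ) - t)) * σ t *
                    SturmLiouville.opK₂ σ σ μ SturmLiouville.unitFun t)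
              + I * cexp (I * μ * (1 - x)) / (2 * μ) *
                  ((∫ t in (0 : ℝ)..x, cexp (2 * I * μ * ((x : ℂ) - t)) * σ t ^ 2)
                    + (∫ t in x..1, cexp (2 * I * μ * ((t : ℂ) - x)) * σ t) *
                      (∫ t in (0 : ℝ)..x, cexp (2 * I * μ * ((x : ℂ) - t)) * σ t ^ 2))
              + I * cexp (I * μ * (1 - x)) / (2 * μ) *
                  (-((∫ t in (0 : ℝ)..x, cexp (2 * I * μ * ((x : ℂ) - t)) * σ t) *
                      (∫ t in x..1, σ t ^ 2))
                    + ∫ t in x..1, σ t ^ 2))‖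
            ≤ C * SturmLiouville.rho σ μ) := by
  -- Square integrability enters only through `σ, σ² ∈ L¹`.
  have hsq : IntervalIntegrable (fun t => σ t ^ 2) volume 0 1 := by
    rw [intervalIntegrable_iff_integrableOn_Icc_of_le zero_le_one]
    simpa only [pow_two] using! hσ.integrable_mul hσ
  have hint : IntervalIntegrable σ volume 0 1 := by
    rw [intervalIntegrable_iff_integrableOn_Icc_of_le zero_le_one]
    exact hσ.integrable one_le_two
  have hint' : IntervalIntegrable (SturmLiouville.reflect σ) volume 0 1 := by
    simpa [SturmLiouville.reflect] using! (hint.comp_sub_left 1).symm.neg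
  have hsq' : IntervalIntegrable (fun t => SturmLiouville.reflect σ t ^ 2) volume 0 1 := by
    simpa [SturmLiouville.reflect] using (hsq.comp_sub_left 1).symm
  obtain ⟨R₁, hR₁, C₁, hC₁, H₁⟩ := SturmLiouville.exists_solution_first hint hsq hr
  obtain ⟨R₂, hR₂, C₂, hC₂, H₂⟩ := SturmLiouville.exists_solution_first hint' hsq' hr
  refine ⟨max R₁ R₂, lt_max_of_lt_left hR₁, max C₁ C₂, lt_max_of_lt_left hC₁, fun μ hμ hR => ?_⟩
  obtain ⟨y₁, u₁, hs₁, b₁₀, b₁₁, e₁⟩ := H₁ μ hμ (lt_of_le_of_lt (le_max_left _ _) hR)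
  obtain ⟨y, u, hs, b₀, b₁, e₂⟩ := H₂ μ hμ (lt_of_le_of_lt (le_max_right _ _) hR)
  have hs₂ := hs.reflect
  -- Reflection with the sign change of `u` exchanges `d₁` at `0` with `d₂` at `1`.
  have b₂₀ : SturmLiouville.diracFst μ (fun x => y (1 - x)) (fun x => -u (1 - x)) 0 = 0 := by
    rw [← b₁]
    simp [SturmLiouville.diracFst, SturmLiouville.diracSnd, sub_eq_add_neg, neg_div]
  have b₂₁ : SturmLiouville.diracSnd μ (fun x => y (1 - x)) (fun x => -u (1 - x)) 1 = 1 := by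
    rw [← b₀]
    simp [SturmLiouville.diracFst, SturmLiouville.diracSnd, neg_div]
  have hρ : 0 ≤ SturmLiouville.rho σ μ :=
    le_trans (by positivity) (SturmLiouville.rho_lower_bounds hint hsq μ).2.2.2.2
  refine ⟨y₁, u₁, _, _, hs₁, hs₂, b₁₀, b₁₁, b₂₀, b₂₁,
    hs₁.linearIndependent hs₂ b₁₀ b₁₁ b₂₀ b₂₁, fun x hx => ?_, fun x hx => ?_⟩
  · rw [← SturmLiouville.cexp_mul_diracApprox]
    exact (e₁ x hx).trans (by gcongr; exact le_max_left _ _)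
  · rw [← SturmLiouville.cexp_mul_diracApprox_reflect]
    refine (e₂ (1 - x) (SturmLiouville.one_sub_mem hx)).trans ?_
    rw [SturmLiouville.rho_reflect]
    gcongr
    exact le_max_right _ _
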